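/- Let $\sigma$ be a permutation of $\{1,\dots,m\}$. A point $(i,\sigma(i))$ is called external if it is a record, that is, a left-to-right maximum, a left-to-right minimum, a right-to-left maximum or a right-to-left minimum of $\sigma$; otherwise it is called internal. For $n,k\ge 0$ let $ASq(n,k)$ be the set of permutations of size $n+k$ that have exactly $n$ external points and exactly $k$ internal points. Let $(k_n)_{n\ge 0}$ be a sequence of nonnegative integers such that $k_n\ge 1$ for all sufficiently large $n$ and $k_n=o(n)$ as $n\to\infty$. Then, as $n\to\infty$, $$\log|ASq(n,k_n)|=\log\left(\frac{k_n!}{(2k_n+1)!}\,2^{k_n+1}\,n^{2k_n+1}\,4^{n-3}\right)+o(k_n).$$ -/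

import Mathlib

open Filter Asymptotics

/-- `i` is the position of a left-to-right maximum of `σ`. -/
def IsLeftToRightMax {m : ℕ} (σ : Equiv.Perm (Fin m)) (i : Fin m) : Prop :=
  ∀ j : Fin m, j < i → σ j < σ i

/-- `i` is the position of a left-to-right minimum of `σ`. -/
def IsLeftToRightMin {m : ℕ} (σ : Equiv.Perm (Fin m)) (i : Fin m) : Prop :=
  ∀ j : Fin m, j < i → σ i < σ j

/-- `i` is the position of a right-to-left maximum of `σ`. -/
def IsRightToLeftMax {m : ℕ} (σ : Equiv.Perm (Fin m)) (i : Fin m) : Prop :=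
  ∀ j : Fin m, i < j → σ j < σ i

/-- `i` is the position of a right-to-left minimum of `σ`. -/
def IsRightToLeftMin {m : ℕ} (σ : Equiv.Perm (Fin m)) (i : Fin m) : Prop :=
  ∀ j : Fin m, i < j → σ i < σ j

/-- The point `(i, σ i)` is external: it is a record (maximum or minimum, from the left or from
the right). -/
def IsExternal {m : ℕ} (σ : Equiv.Perm (Fin m)) (i : Fin m) : Prop :=
  IsLeftToRightMax σ i ∨ IsLeftToRightMin σ i ∨ IsRightToLeftMax σ i ∨ IsRightToLeftMin σ i

/-- The point `(i, σ i)` is internal: it is not external. -/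
def IsInternal {m : ℕ} (σ : Equiv.Perm (Fin m)) (i : Fin m) : Prop :=
  ¬ IsExternal σ i

instance {m : ℕ} (σ : Equiv.Perm (Fin m)) (i : Fin m) : Decidable (IsExternal σ i) := by
  unfold IsExternal IsLeftToRightMax IsLeftToRightMin IsRightToLeftMax IsRightToLeftMin
  infer_instance

instance {m : ℕ} (σ : Equiv.Perm (Fin m)) (i : Fin m) : Decidable (IsInternal σ i) := by
  unfold IsInternal
  infer_instance

/-- The (positions of the) external points of a permutation. -/
def externalPoints {m : ℕ} (σ : Equiv.Perm (Fin m)) : Finset (Fin m) :=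
  {i | IsExternal σ i}

/-- The (positions of the) internal points of a permutation. -/
def internalPoints {m : ℕ} (σ : Equiv.Perm (Fin m)) : Finset (Fin m) :=
  {i | IsInternal σ i}

/-- The set of almost square permutations of size `n + k` with exactly `n` external points and
exactly `k` internal points. -/
def ASq (n k : ℕ) : Finset (Equiv.Perm (Fin (n + k))) :=
  {σ | (externalPoints σ).card = n ∧ (internalPoints σ).card = k}

/-! Removing an internal point leaves every other point external or internal as it was. The converse
operation inserts a point in a cell whose four quadrants are all occupied. Counting pairs
(permutation, marked internal point) in two ways and iterating gives `k! * |ASq(n,k)|` as roughly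
the sum, over the square permutations (those without internal points), of the `k`-th power of the
number of inner cells. Each insertion adds only `O(n + k)` cells to a number typically of order `n ^
2`, which is harmless because `k = o(n)`: see `factorial_mul_card_ASq_le` and
`sum_card_innerCells_pow_le`.

A square permutation, read clockwise from its lowest point, is determined by the column `z` of that
point, a lower/upper label for each column and a left/right label for each row
(`exists_eq_squareOf`). When the labels are balanced, the points hug the rectangle with corners
`(z,0)`, `(0,z)`, `(n-z,n)`, `(n,n-z)`. If `z` is also away from the ends, every such code gives a
square permutation (`isExternal_squareOf`) and can be recovered from it (`squareOf_injective`). The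
inner cells fill the rectangle, so their number is about its area `2z(n-z)`.

A Chernoff bound makes unbalanced labels exponentially rare in `n`. For a fixed interior `z` there
are `4^n/32` codes, so `k! * |ASq(n,k)|` is close to `4^n/32` times the sum over `z` of
`(2z(n-1-z))^k`. That sum is asymptotically the Beta integral `n^(2k+1) * 2^k * k!^2 / (2k+1)!`,
evaluated by a convolution of binomial coefficients. All errors are factors `exp(O(η k))` with `η`
arbitrary, hence `o(k)` after taking logarithms. -/

/-! ### Insertion and removal of internal points -/

/-- The cell with `a` columns to its left and `b` rows below it has a point of `σ` in each of its
four quadrants, so that a point inserted there is internal. -/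
def IsInnerCell {m : ℕ} (σ : Equiv.Perm (Fin m)) (a b : ℕ) : Prop :=
  (∃ i : Fin m, (i : ℕ) < a ∧ (σ i : ℕ) < b) ∧ (∃ i : Fin m, (i : ℕ) < a ∧ b ≤ (σ i : ℕ)) ∧
    (∃ i : Fin m, a ≤ (i : ℕ) ∧ (σ i : ℕ) < b) ∧ (∃ i : Fin m, a ≤ (i : ℕ) ∧ b ≤ (σ i : ℕ))

instance {m : ℕ} (σ : Equiv.Perm (Fin m)) (a b : ℕ) : Decidable (IsInnerCell σ a b) := by
  unfold IsInnerCell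
  infer_instance

/-- The cells in which an inserted point is internal. -/
def innerCells {m : ℕ} (σ : Equiv.Perm (Fin m)) : Finset (Fin (m + 1) × Fin (m + 1)) :=
  {p | IsInnerCell σ p.1 p.2}

/-- Insert the point `(a, b)` into the diagram of `σ`. -/
def insertPoint {m : ℕ} (σ : Equiv.Perm (Fin m)) (a b : Fin (m + 1)) :
    Equiv.Perm (Fin (m + 1)) :=
  (finSuccEquiv' a).trans ((Equiv.optionCongr σ).trans (finSuccEquiv' b).symm)

@[simp] lemma insertPoint_self {m : ℕ} (σ : Equiv.Perm (Fin m)) (a b : Fin (m + 1)) :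
    insertPoint σ a b a = b := by
  simp [insertPoint]

@[simp] lemma insertPoint_succAbove {m : ℕ} (σ : Equiv.Perm (Fin m)) (a b : Fin (m + 1))
    (i : Fin m) : insertPoint σ a b (a.succAbove i) = b.succAbove (σ i) := by
  simp [insertPoint]

lemma exists_eq_insertPoint {m : ℕ} (τ : Equiv.Perm (Fin (m + 1))) (a : Fin (m + 1)) :
    ∃ σ : Equiv.Perm (Fin m), τ = insertPoint σ a (τ a) := by
  have h : ((finSuccEquiv' a).symm.trans (τ.trans (finSuccEquiv' (τ a)))) none = none := by simp
  refine ⟨Equiv.removeNone ((finSuccEquiv' a).symm.trans (τ.trans (finSuccEquiv' (τ a)))), ?_⟩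
  refine Equiv.ext fun x => ?_
  rcases Fin.eq_self_or_eq_succAbove a x with rfl | ⟨i, rfl⟩
  · simp
  rw [insertPoint_succAbove]
  obtain ⟨j, hj⟩ := Fin.exists_succAbove_eq (x := τ (a.succAbove i)) (y := τ a)
    (fun hc => Fin.succAbove_ne a i (τ.injective hc))
  rw [← hj]
  congr 1
  refine Option.some_injective _ ?_
  rw [Equiv.removeNone_some _ ⟨j, ?_⟩] <;> simp [← hj]

lemma insertPoint_injective {m : ℕ} {σ σ' : Equiv.Perm (Fin m)} {a b : Fin (m + 1)}
    (h : insertPoint σ a b = insertPoint σ' a b) : σ = σ' := by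
  ext i
  have := congrArg (fun τ : Equiv.Perm (Fin (m + 1)) => τ (a.succAbove i)) h
  simp only [insertPoint_succAbove] at this
  rw [Fin.succAbove_right_injective this]

lemma val_succAbove_lt {m : ℕ} (c : Fin (m + 1)) (i : Fin m) :
    c.succAbove i < c ↔ (i : ℕ) < c := by
  rw [Fin.succAbove_lt_iff_castSucc_lt, Fin.lt_def, Fin.val_castSucc]

lemma lt_val_succAbove {m : ℕ} (c : Fin (m + 1)) (i : Fin m) :
    c < c.succAbove i ↔ (c : ℕ) ≤ i := by
  rw [Fin.lt_succAbove_iff_le_castSucc, Fin.le_def, Fin.val_castSucc]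

lemma isInternal_insertPoint_self {m : ℕ} (σ : Equiv.Perm (Fin m)) (a b : Fin (m + 1)) :
    IsInternal (insertPoint σ a b) a ↔ IsInnerCell σ a b := by
  simp only [IsInternal, IsExternal, IsLeftToRightMax, IsLeftToRightMin, IsRightToLeftMax,
    IsRightToLeftMin, Fin.forall_iff_succAbove a, insertPoint_self, insertPoint_succAbove,
    lt_irrefl, IsInnerCell, not_or, not_forall, false_imp_iff, true_and,
    val_succAbove_lt, lt_val_succAbove, exists_prop]
  simp only [← not_lt, not_not]
  tauto

/-- The new point destroys no record: if it lay on the side that a record must beat, the old point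
in the appropriate quadrant of the cell would lie on that side too, and it is at least as hard to
beat. -/
lemma isExternal_insertPoint_succAbove {m : ℕ} {σ : Equiv.Perm (Fin m)} {a b : Fin (m + 1)}
    (h : IsInnerCell σ a b) (i : Fin m) :
    IsExternal (insertPoint σ a b) (a.succAbove i) ↔ IsExternal σ i := by
  obtain ⟨⟨j₁, h₁, h₁'⟩, ⟨j₂, h₂, h₂'⟩, ⟨j₃, h₃, h₃'⟩, ⟨j₄, h₄, h₄'⟩⟩ := h
  have key : ∀ p q : Prop, (q → p) → ((p ∧ q) ↔ q) := by tauto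
  unfold IsExternal
  refine or_congr ?_ (or_congr ?_ (or_congr ?_ ?_)) <;>
  simp only [IsLeftToRightMax, IsLeftToRightMin, IsRightToLeftMax,
    IsRightToLeftMin, Fin.forall_iff_succAbove a, insertPoint_self, insertPoint_succAbove,
    val_succAbove_lt, lt_val_succAbove, Fin.succAbove_lt_succAbove_iff] <;>
  refine key _ _ ?_ <;> intro hq hai
  · have := Fin.lt_def.1 (hq j₂ (Fin.lt_def.2 (by omega)))
    omega
  · have := Fin.lt_def.1 (hq j₁ (Fin.lt_def.2 (by omega)))
    omega
  · have := Fin.lt_def.1 (hq j₄ (Fin.lt_def.2 (by omega)))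
    omega
  · have := Fin.lt_def.1 (hq j₃ (Fin.lt_def.2 (by omega)))
    omega

lemma card_externalPoints_insertPoint {m : ℕ} {σ : Equiv.Perm (Fin m)} {a b : Fin (m + 1)}
    (h : IsInnerCell σ a b) :
    (externalPoints (insertPoint σ a b)).card = (externalPoints σ).card := by
  have : externalPoints (insertPoint σ a b) = (externalPoints σ).map a.succAboveEmb := by
    ext x
    rcases Fin.eq_self_or_eq_succAbove a x with rfl | ⟨i, rfl⟩
    · have := (isInternal_insertPoint_self σ x b).2 h
      simpa [externalPoints, IsInternal] using this
    · simp [externalPoints, isExternal_insertPoint_succAbove h]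
  rw [this, Finset.card_map]

lemma card_externalPoints_add_card_internalPoints {m : ℕ} (σ : Equiv.Perm (Fin m)) :
    (externalPoints σ).card + (internalPoints σ).card = m := by
  have := Finset.card_filter_add_card_filter_not (s := (Finset.univ : Finset (Fin m)))
    (fun i => IsExternal σ i)
  simpa [externalPoints, internalPoints, IsInternal] using this

lemma mem_ASq {n k : ℕ} {σ : Equiv.Perm (Fin (n + k))} :
    σ ∈ ASq n k ↔ (externalPoints σ).card = n := by
  have := card_externalPoints_add_card_internalPoints σ
  simp only [ASq, Finset.mem_filter, Finset.mem_univ, true_and]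
  omega

lemma card_internalPoints_of_mem_ASq {n k : ℕ} {σ : Equiv.Perm (Fin (n + k))}
    (h : σ ∈ ASq n k) : (internalPoints σ).card = k := by
  simp only [ASq, Finset.mem_filter, Finset.mem_univ, true_and] at h
  exact h.2

/-- The double count: deleting a marked internal point is a bijection onto pairs of a smaller
permutation and an inner cell. The weight `f` is kept general so that the count can be iterated with
powers of the number of inner cells. -/
lemma sum_internalPoints_ASq_succ {M : Type*} [AddCommMonoid M] (n k : ℕ)
    (f : Equiv.Perm (Fin (n + (k + 1))) → M) :
    ∑ τ ∈ ASq n (k + 1), ∑ _a ∈ internalPoints τ, f τ =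
      ∑ σ ∈ ASq n k, ∑ p ∈ innerCells σ, f (insertPoint σ p.1 p.2) := by
  rw [Finset.sum_sigma', Finset.sum_sigma']
  symm
  refine Finset.sum_bij (fun x _ => ⟨insertPoint x.1 x.2.1 x.2.2, x.2.1⟩) ?_ ?_ ?_ ?_
  · rintro ⟨σ, a, b⟩ h
    simp only [Finset.mem_sigma, innerCells, Finset.mem_filter, Finset.mem_univ, true_and] at h
    simp only [Finset.mem_sigma, internalPoints, Finset.mem_filter, Finset.mem_univ, true_and]
    refine ⟨?_, (isInternal_insertPoint_self σ a b).2 h.2⟩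
    exact mem_ASq.2 ((card_externalPoints_insertPoint h.2).trans (mem_ASq.1 h.1))
  · rintro ⟨σ, a, b⟩ _ ⟨σ', a', b'⟩ _ h
    simp only [Sigma.mk.injEq, heq_eq_eq] at h
    obtain ⟨h, rfl⟩ := h
    have hb : b = b' := by
      have := congrArg (fun τ : Equiv.Perm (Fin (n + k + 1)) => τ a) h
      simpa using this
    subst hb
    rw [insertPoint_injective h]
  · rintro ⟨τ, a⟩ h
    simp only [Finset.mem_sigma, internalPoints, Finset.mem_filter, Finset.mem_univ,
      true_and] at h
    obtain ⟨σ, hσ⟩ := exists_eq_insertPoint (m := n + k) τ a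
    generalize τ a = b at hσ
    subst hσ
    have hc := (isInternal_insertPoint_self σ a b).1 h.2
    refine ⟨⟨σ, a, b⟩, ?_, rfl⟩
    simp only [Finset.mem_sigma, innerCells, Finset.mem_filter, Finset.mem_univ, true_and]
    exact ⟨mem_ASq.2 ((card_externalPoints_insertPoint hc).symm.trans (mem_ASq.1 h.1)), hc⟩
  · intros
    rfl

/-- The grid line `a` splits into `a` and `a + 1`, and `a.succ.succAbove` omits the second. A
quadrant of an old cell that receives the new point already contains an old one, namely the witness
in the same quadrant of `(a, b)`. -/
lemma isInnerCell_insertPoint {m : ℕ} {σ : Equiv.Perm (Fin m)} {a b : Fin (m + 1)}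
    (h : IsInnerCell σ a b) (x y : Fin (m + 1)) :
    IsInnerCell (insertPoint σ a b) (a.succ.succAbove x) (b.succ.succAbove y) ↔
      IsInnerCell σ x y := by
  obtain ⟨⟨j₁, h₁, h₁'⟩, ⟨j₂, h₂, h₂'⟩, ⟨j₃, h₃, h₃'⟩, ⟨j₄, h₄, h₄'⟩⟩ := h
  have old : ∀ (c x : Fin (m + 1)) (i : Fin m),
      ((c.succAbove i : Fin (m + 1)) : ℕ) < (c.succ.succAbove x : Fin (m + 2)) ↔
        (i : ℕ) < x := by
    intro c x i
    simp only [Fin.succAbove, Fin.lt_def, Fin.val_castSucc, Fin.val_succ]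
    split_ifs <;> simp only [Fin.val_castSucc, Fin.val_succ] <;> omega
  have new : ∀ c x : Fin (m + 1), (c : ℕ) < (c.succ.succAbove x : Fin (m + 2)) ↔
      (c : ℕ) < x := by
    intro c x
    simp only [Fin.succAbove, Fin.lt_def, Fin.val_castSucc, Fin.val_succ]
    split_ifs <;> simp only [Fin.val_castSucc, Fin.val_succ]
    all_goals omega
  simp only [IsInnerCell, Fin.exists_iff_succAbove a, insertPoint_self, insertPoint_succAbove,
    ← not_lt, old, new]
  have key : ∀ p q : Prop, (p → q) → ((p ∨ q) ↔ q) := by tauto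
  exact and_congr (key _ _ fun _ => ⟨j₁, by omega⟩) (and_congr (key _ _ fun _ => ⟨j₂, by omega⟩)
    (and_congr (key _ _ fun _ => ⟨j₃, by omega⟩) (key _ _ fun _ => ⟨j₄, by omega⟩)))

lemma card_innerCells_le_insertPoint {m : ℕ} {σ : Equiv.Perm (Fin m)} {a b : Fin (m + 1)}
    (h : IsInnerCell σ a b) : (innerCells σ).card ≤ (innerCells (insertPoint σ a b)).card := by
  refine Finset.card_le_card_of_injOn
    (fun p => (a.succ.succAbove p.1, b.succ.succAbove p.2)) ?_ ?_
  · rintro ⟨x, y⟩ hp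
    simp only [innerCells, Finset.coe_filter, Finset.mem_univ, true_and, Set.mem_ofPred_eq] at hp ⊢
    exact (isInnerCell_insertPoint h x y).2 hp
  · rintro ⟨x, y⟩ _ ⟨x', y'⟩ _ hp
    simpa using hp

lemma card_innerCells_insertPoint_le {m : ℕ} {σ : Equiv.Perm (Fin m)} {a b : Fin (m + 1)}
    (h : IsInnerCell σ a b) :
    (innerCells (insertPoint σ a b)).card ≤ (innerCells σ).card + 2 * (m + 2) := by
  -- A cell that does not come from an old one lies on the new vertical or the new horizontal grid
  -- line, and each of these carries `m + 2` cells.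
  have hsub : innerCells (insertPoint σ a b) ⊆
      ((innerCells σ).image fun p => (a.succ.succAbove p.1, b.succ.succAbove p.2)) ∪
        (({a.succ} ×ˢ Finset.univ) ∪ (Finset.univ ×ˢ {b.succ})) := by
    rintro ⟨x, y⟩ hp
    rcases Fin.eq_self_or_eq_succAbove a.succ x with rfl | ⟨x, rfl⟩
    · simp
    rcases Fin.eq_self_or_eq_succAbove b.succ y with rfl | ⟨y, rfl⟩
    · simp
    simp only [innerCells, Finset.mem_filter, Finset.mem_univ, true_and] at hp
    rw [isInnerCell_insertPoint h] at hp
    refine Finset.mem_union_left _ (Finset.mem_image.2 ⟨(x, y), ?_, rfl⟩)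
    simpa [innerCells] using hp
  refine (Finset.card_le_card hsub).trans ((Finset.card_union_le _ _).trans ?_)
  refine add_le_add Finset.card_image_le ((Finset.card_union_le _ _).trans ?_)
  simp only [Finset.card_product, Finset.card_singleton, Finset.card_univ, Fintype.card_fin]
  omega

/-- Each deletion turns one factor of `k!` into one more power of the number of cells. The exponent
`j` and the shift `e` vary so that the induction can accumulate both; `N` bounds all the sizes,
making the shift per insertion uniform. -/
lemma factorial_mul_sum_ASq_le (n N : ℕ) : ∀ k j e : ℕ, n + k ≤ N →
    k.factorial * ∑ σ ∈ ASq n k, ((innerCells σ).card + e) ^ j ≤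
      ∑ σ ∈ ASq n 0, ((innerCells σ).card + (e + k * (2 * (N + 2)))) ^ (j + k) := by
  intro k
  induction k with
  | zero => intro j e _; simp
  | succ k ih =>
    intro j e hN
    refine le_trans ?_ ((ih (j + 1) (e + 2 * (N + 2)) (by omega)).trans (le_of_eq ?_))
    · rw [Nat.factorial_succ, mul_comm (k + 1), mul_assoc]
      refine Nat.mul_le_mul_left _ ?_
      calc (k + 1) * ∑ τ ∈ ASq n (k + 1), ((innerCells τ).card + e) ^ j
          = ∑ τ ∈ ASq n (k + 1), ∑ _a ∈ internalPoints τ, ((innerCells τ).card + e) ^ j := by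
            rw [Finset.mul_sum]
            refine Finset.sum_congr rfl fun τ hτ => ?_
            rw [Finset.sum_const, card_internalPoints_of_mem_ASq hτ, smul_eq_mul]
        _ = _ := sum_internalPoints_ASq_succ n k _
        _ ≤ ∑ σ ∈ ASq n k, ∑ _p ∈ innerCells σ,
              ((innerCells σ).card + (e + 2 * (N + 2))) ^ j := by
            refine Finset.sum_le_sum fun σ _ => Finset.sum_le_sum fun p hp => ?_
            have := card_innerCells_insertPoint_le (Finset.mem_filter.1 hp).2
            exact Nat.pow_le_pow_left (by omega) j
        _ ≤ _ := by
            refine Finset.sum_le_sum fun σ _ => ?_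
            rw [Finset.sum_const, smul_eq_mul, pow_succ, mul_comm]
            exact Nat.mul_le_mul_left _ (by omega)
    · refine Finset.sum_congr rfl fun σ _ => ?_
      ring_nf

lemma sum_ASq_zero_le (n : ℕ) : ∀ k j : ℕ,
    ∑ σ ∈ ASq n 0, (innerCells σ).card ^ (j + k) ≤
      k.factorial * ∑ σ ∈ ASq n k, (innerCells σ).card ^ j := by
  intro k
  induction k with
  | zero => intro j; simp
  | succ k ih =>
    intro j
    refine le_trans (le_of_eq ?_) ((ih (j + 1)).trans ?_)
    · refine Finset.sum_congr rfl fun σ _ => ?_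
      congr 1; ring
    · rw [Nat.factorial_succ, mul_comm (k + 1), mul_assoc]
      refine Nat.mul_le_mul_left _ ?_
      calc ∑ σ ∈ ASq n k, (innerCells σ).card ^ (j + 1)
          = ∑ σ ∈ ASq n k, ∑ _p ∈ innerCells σ, (innerCells σ).card ^ j := by
            refine Finset.sum_congr rfl fun σ _ => ?_
            rw [Finset.sum_const, smul_eq_mul, pow_succ, mul_comm]
        _ ≤ _ := by
            refine Finset.sum_le_sum fun σ _ => Finset.sum_le_sum fun p hp => ?_
            exact Nat.pow_le_pow_left
              (card_innerCells_le_insertPoint (Finset.mem_filter.1 hp).2) j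
        _ = _ := (sum_internalPoints_ASq_succ n k fun τ => (innerCells τ).card ^ j).symm
        _ = _ := by
            rw [Finset.mul_sum]
            refine Finset.sum_congr rfl fun τ hτ => ?_
            rw [Finset.sum_const, card_internalPoints_of_mem_ASq hτ, smul_eq_mul]

/-- Upper bound for almost square permutations in terms of square ones. -/
lemma factorial_mul_card_ASq_le (n k : ℕ) :
    k.factorial * (ASq n k).card ≤
      ∑ σ ∈ ASq n 0, ((innerCells σ).card + k * (2 * (n + k + 2))) ^ k := by
  simpa using factorial_mul_sum_ASq_le n (n + k) k 0 0 le_rfl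

/-- Lower bound for almost square permutations in terms of square ones. -/
lemma sum_card_innerCells_pow_le (n k : ℕ) :
    ∑ σ ∈ ASq n 0, (innerCells σ).card ^ k ≤ k.factorial * (ASq n k).card := by
  simpa using sum_ASq_zero_le n k 0

/-! ### Clockwise codes of square permutations -/

/-- The permutation that matches the order on columns given by `f` with the order on rows given
by `g`. -/
def matchingPerm {n : ℕ} (f g : Fin n → ℤ) : Equiv.Perm (Fin n) :=
  (Tuple.sort f).symm.trans (Tuple.sort g)

lemma strictMono_comp_sort {n : ℕ} {f : Fin n → ℤ} (hf : Function.Injective f) :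
    StrictMono (f ∘ Tuple.sort f) :=
  (Tuple.monotone_sort f).strictMono_of_injective (hf.comp (Tuple.sort f).injective)

lemma matchingPerm_lt_iff {n : ℕ} {f g : Fin n → ℤ} (hf : Function.Injective f)
    (hg : Function.Injective g) (c c' : Fin n) :
    g (matchingPerm f g c) < g (matchingPerm f g c') ↔ f c < f c' := by
  have h₁ := (strictMono_comp_sort hg).lt_iff_lt (a := (Tuple.sort f).symm c)
    (b := (Tuple.sort f).symm c')
  have h₂ := (strictMono_comp_sort hf).lt_iff_lt (a := (Tuple.sort f).symm c)
    (b := (Tuple.sort f).symm c')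
  simp only [Function.comp_apply, Equiv.apply_symm_apply] at h₁ h₂
  exact h₁.trans h₂.symm

lemma eq_matchingPerm {n : ℕ} {f g : Fin n → ℤ} (hf : Function.Injective f)
    (hg : Function.Injective g) {π : Equiv.Perm (Fin n)}
    (h : ∀ c c', f c < f c' → g (π c) < g (π c')) : π = matchingPerm f g := by
  have h₁ : Monotone (g ∘ ((Tuple.sort f).trans π)) := by
    refine StrictMono.monotone fun i j hij => ?_
    exact h _ _ (strictMono_comp_sort hf hij)
  have h₂ := Tuple.unique_monotone h₁ (Tuple.monotone_sort g)
  ext c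
  have h₃ := congrFun h₂ ((Tuple.sort f).symm c)
  simp only [Function.comp_apply, Equiv.trans_apply, Equiv.apply_symm_apply] at h₃
  rw [hg h₃]
  rfl

/-- Equality of the rank of a column and the rank of its row is what later locates the points in the
plane. -/
lemma card_matchingPerm {n : ℕ} {f g : Fin n → ℤ} (hf : Function.Injective f)
    (hg : Function.Injective g) (c : Fin n) :
    (Finset.univ.filter fun c' => f c' < f c).card =
      (Finset.univ.filter fun r => g r < g (matchingPerm f g c)).card := by
  refine Finset.card_equiv (matchingPerm f g) fun c' => ?_
  simp [matchingPerm_lt_iff hf hg]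

/-- Position of a column in the clockwise order around a square permutation starting from the
lowest point, in column `z`; `X c` says that the point in column `c` is a lower record. -/
def colKey {n : ℕ} (X : Fin n → Bool) (z c : Fin n) : ℤ :=
  if X c then (if c ≤ z then -(c : ℤ) else 2 * n - c) else c

/-- Position of a row in the clockwise order around a square permutation starting from the
lowest point; `Y r` says that the point in row `r` is a left record. -/
def rowKey {n : ℕ} (Y : Fin n → Bool) (r : Fin n) : ℤ :=
  if Y r then r else 2 * n - r

lemma colKey_injective {n : ℕ} (X : Fin n → Bool) (z : Fin n) :
    Function.Injective (colKey X z) := by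
  intro c c' h
  unfold colKey at h
  have := c.isLt
  have := c'.isLt
  ext
  rcases hc : X c <;> rcases hc' : X c' <;> simp only [hc, hc'] at h <;> split_ifs at h <;>
    omega

lemma rowKey_injective {n : ℕ} (Y : Fin n → Bool) : Function.Injective (rowKey Y) := by
  intro c c' h
  unfold rowKey at h
  ext
  split_ifs at h <;> omega

/-- The permutation whose points, read clockwise from the lowest one, lie in the columns as
ordered by `colKey X z` and in the rows as ordered by `rowKey Y`. -/
def squareOf {n : ℕ} (X Y : Fin n → Bool) (z : Fin n) : Equiv.Perm (Fin n) :=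
  matchingPerm (colKey X z) (rowKey Y)

/-- The first and the last label are `true`. -/
def EndsTrue {n : ℕ} (X : Fin n → Bool) : Prop :=
  ∀ i : Fin n, (i : ℕ) = 0 ∨ (i : ℕ) + 1 = n → X i = true

instance {n : ℕ} (X : Fin n → Bool) : Decidable (EndsTrue X) := by
  unfold EndsTrue
  infer_instance

instance {m : ℕ} (σ : Equiv.Perm (Fin m)) (i : Fin m) : Decidable (IsLeftToRightMax σ i) := by
  unfold IsLeftToRightMax
  infer_instance

instance {m : ℕ} (σ : Equiv.Perm (Fin m)) (i : Fin m) : Decidable (IsLeftToRightMin σ i) := by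
  unfold IsLeftToRightMin
  infer_instance

instance {m : ℕ} (σ : Equiv.Perm (Fin m)) (i : Fin m) : Decidable (IsRightToLeftMin σ i) := by
  unfold IsRightToLeftMin
  infer_instance

/-- Every square permutation is encoded by its record labels and its lowest column. -/
theorem exists_eq_squareOf {n : ℕ} (hn : 0 < n) {π : Equiv.Perm (Fin n)}
    (hπ : ∀ i, IsExternal π i) :
    ∃ X Y : Fin n → Bool, ∃ z : Fin n, EndsTrue X ∧ EndsTrue Y ∧ X z = true ∧
      π = squareOf X Y z := by
  -- A point may be a record of several types, so the labels need a tie-break. A left-to-right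
  -- minimum counts as lower, a left-to-right maximum takes precedence over a right-to-left minimum,
  -- and the last column is made lower by force, as `EndsTrue` requires.
  let X : Fin n → Bool := fun c => decide (IsLeftToRightMin π c ∨
    (¬ IsLeftToRightMax π c ∧ IsRightToLeftMin π c) ∨ (c : ℕ) + 1 = n)
  let Y : Fin n → Bool := fun r => decide (IsLeftToRightMin π (π.symm r) ∨
    IsLeftToRightMax π (π.symm r))
  let z : Fin n := π.symm ⟨0, hn⟩
  have hz : (π z : ℕ) = 0 := by simp [z]
  have hA : ∀ c c' : Fin n, IsLeftToRightMin π c → (c' : ℕ) < c → (π c : ℕ) < π c' :=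
    fun c c' h h' => h c' h'
  have hB : ∀ c c' : Fin n, IsLeftToRightMax π c → (c' : ℕ) < c → (π c' : ℕ) < π c :=
    fun c c' h h' => h c' h'
  have hC : ∀ c c' : Fin n, IsRightToLeftMax π c → (c : ℕ) < c' → (π c' : ℕ) < π c :=
    fun c c' h h' => h c' h'
  have hD : ∀ c c' : Fin n, IsRightToLeftMin π c → (c : ℕ) < c' → (π c : ℕ) < π c' :=
    fun c c' h h' => h c' h'
  have hAz : IsLeftToRightMin π z := by
    intro j hj
    rw [Fin.lt_def, hz]
    by_contra h0
    exact hj.ne (π.injective (Fin.ext (by omega)))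
  have last : ∀ c : Fin n, (c : ℕ) + 1 = n → IsRightToLeftMax π c ∧ IsRightToLeftMin π c := by
    intro c hc
    exact ⟨fun j hj => absurd (Fin.lt_def.1 hj) (by omega),
      fun j hj => absurd (Fin.lt_def.1 hj) (by omega)⟩
  have inj : ∀ c c' : Fin n, (π c : ℕ) = π c' → (c : ℕ) = c' := by
    intro c c' h
    rw [π.injective (Fin.ext h)]
  have top : ∀ c : Fin n, (c : ℕ) + 1 = n → IsLeftToRightMax π c → (π c : ℕ) + 1 = n := by
    intro c hc h
    by_contra hne
    obtain ⟨d, hd⟩ := π.surjective ⟨n - 1, by omega⟩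
    have hd' : (π d : ℕ) = n - 1 := by rw [hd]
    have h₁ := hB c d h
    have h₂ : d = c → (π d : ℕ) = π c := fun h => by rw [h]
    rw [Fin.ext_iff] at h₂
    have := d.isLt
    have := (π c).isLt
    omega
  -- The first two and the last two alternatives are the four sides. The third is the exception made
  -- by the forced label: a highest point in the last column, lower as a column but left as a row.
  have cls : ∀ c : Fin n,
      ((c : ℕ) ≤ z ∧ IsLeftToRightMin π c ∧ colKey X z c = -(c : ℤ) ∧
        rowKey Y (π c) = (π c : ℕ)) ∨
      ((z : ℕ) < c ∧ IsRightToLeftMin π c ∧ colKey X z c = 2 * n - (c : ℤ) ∧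
        rowKey Y (π c) = 2 * n - ((π c : ℕ) : ℤ)) ∨
      ((z : ℕ) < c ∧ (c : ℕ) + 1 = n ∧ (π c : ℕ) + 1 = n ∧ colKey X z c = 2 * n - (c : ℤ) ∧
        rowKey Y (π c) = (π c : ℕ)) ∨
      ((c : ℕ) + 1 ≠ n ∧ IsLeftToRightMax π c ∧ colKey X z c = (c : ℤ) ∧
        rowKey Y (π c) = (π c : ℕ)) ∨
      ((c : ℕ) + 1 ≠ n ∧ IsRightToLeftMax π c ∧ colKey X z c = (c : ℤ) ∧
        rowKey Y (π c) = 2 * n - ((π c : ℕ) : ℤ)) := by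
    intro c
    have hX : X c = true ↔ (IsLeftToRightMin π c ∨
      (¬ IsLeftToRightMax π c ∧ IsRightToLeftMin π c) ∨ (c : ℕ) + 1 = n) := by simp [X]
    have hY : Y (π c) = true ↔ (IsLeftToRightMin π c ∨ IsLeftToRightMax π c) := by simp [Y]
    have hE := hπ c
    unfold IsExternal at hE
    have h₁ := last c
    have h₂ := top c
    have h₃ := hA c z
    have h₄ := hD c z
    have h₅ : (z : ℕ) = c → IsLeftToRightMin π c := fun h => by rwa [← Fin.ext h]
    simp only [colKey, rowKey, Fin.le_def]
    have upper : X c ≠ true → ((c : ℕ) + 1 ≠ n ∧ IsLeftToRightMax π c ∧ Y (π c) = true) ∨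
        ((c : ℕ) + 1 ≠ n ∧ IsRightToLeftMax π c ∧ Y (π c) = false) := by
      intro hXc
      have hXc' := mt hX.2 hXc
      have hnA : ¬ IsLeftToRightMin π c := fun h => hXc' (Or.inl h)
      have hnl : (c : ℕ) + 1 ≠ n := fun h => hXc' (Or.inr (Or.inr h))
      by_cases hB : IsLeftToRightMax π c
      · exact Or.inl ⟨hnl, hB, hY.2 (Or.inr hB)⟩
      · have hnD : ¬ IsRightToLeftMin π c := fun h => hXc' (Or.inr (Or.inl ⟨hB, h⟩))
        refine Or.inr ⟨hnl, ?_, ?_⟩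
        · simpa [hnA, hB, hnD] using hE
        · simpa [hnA, hB] using mt hY.1
    by_cases hcz : (c : ℕ) ≤ z
    · simp only [hcz, if_true]
      by_cases hXc : X c = true
      · simp only [hXc, if_true]
        left
        have hc : IsLeftToRightMin π c := by
          rcases hX.1 hXc with h | ⟨_, h⟩ | h
          · exact h
          · have := h₄ h
            exact h₅ (by omega)
          · have := z.isLt
            exact h₅ (by omega)
        simp [hc, hY.2 (Or.inl hc)]
      · rcases upper hXc with ⟨h₁, h₂, h₃⟩ | ⟨h₁, h₂, h₃⟩ <;> simp [hXc, h₁, h₂, h₃]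
    · simp only [hcz, if_false]
      have hnA : ¬ IsLeftToRightMin π c := by
        intro h
        have := h₃ h
        omega
      by_cases hXc : X c = true
      · simp only [hXc, if_true]
        by_cases hB : IsLeftToRightMax π c
        · right; right; left
          simp [hY.2 (Or.inr hB)]
          have : (c : ℕ) + 1 = n := by simpa [hnA, hB] using hX.1 hXc
          exact ⟨by omega, this, h₂ this hB⟩
        · right; left
          have hYc : Y (π c) = false := by simpa [hnA, hB] using mt hY.1
          have hD : IsRightToLeftMin π c := by
            have h := hX.1 hXc
            simp only [hnA, hB, not_false_eq_true, true_and, false_or] at h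
            exact h.elim id fun h => (last c h).2
          simpa [hYc, hD] using hcz
      · rcases upper hXc with ⟨h₁, h₂, h₃⟩ | ⟨h₁, h₂, h₃⟩ <;> simp [hXc, h₁, h₂, h₃]
  refine ⟨X, Y, z, ?_, ?_, ?_, ?_⟩
  · rintro c (hc | hc)
    · have : IsLeftToRightMin π c := fun j hj => absurd (Fin.lt_def.1 hj) (by omega)
      simp [X, this]
    · simp [X, hc]
  · rintro r (hr | hr)
    · have : π.symm r = z := by
        simp only [z]
        congr 1
        exact Fin.ext hr
      simp [Y, this, hAz]
    · have : IsLeftToRightMax π (π.symm r) := by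
        intro j hj
        have h₁ : π j ≠ r := fun h => hj.ne (by simp [← h])
        have h₂ := (π j).isLt
        rw [Equiv.apply_symm_apply, Fin.lt_def]
        rw [Ne, Fin.ext_iff] at h₁
        omega
      simp [Y, this]
  · simp [X, hAz]
  · refine eq_matchingPerm (colKey_injective X z) (rowKey_injective Y) fun c c' h => ?_
    have hl := c.isLt
    have hl' := c'.isLt
    have hp := (π c).isLt
    have hp' := (π c').isLt
    have hi := inj c c'
    have hi' : (c : ℕ) ≠ c' := fun hcc => by
      rw [Fin.ext hcc] at h
      exact lt_irrefl _ h
    rcases cls c with ⟨a₁, a₂, e₁, e₂⟩ | ⟨a₁, a₂, e₁, e₂⟩ | ⟨a₁, a₂, a₃, e₁, e₂⟩ |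
      ⟨a₁, a₂, e₁, e₂⟩ | ⟨a₁, a₂, e₁, e₂⟩ <;>
    rcases cls c' with ⟨b₁, b₂, d₁, d₂⟩ | ⟨b₁, b₂, d₁, d₂⟩ | ⟨b₁, b₂, b₃, d₁, d₂⟩ |
      ⟨b₁, b₂, d₁, d₂⟩ | ⟨b₁, b₂, d₁, d₂⟩ <;>
    rw [e₁, d₁] at h <;> rw [e₂, d₂] <;>
    first
    | omega
    | (have w := hA c c' a₂
       first
       | omega
       | (have w' := hB c' c b₂
          omega))
    | (have w := hB c c' a₂
       first
       | omega
       | (have w' := hB c' c b₂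
          omega))
    | (have w := hC c c' a₂
       first
       | omega
       | (have w' := hD c' c b₂
          omega)
       | (have w' := hB c' c b₂
          omega))
    | (have w := hD c' c b₂
       omega)

/-! ### Balanced labels and the tilted rectangle -/

/-- The number of labels `true` among the first `t`. -/
def prefixCount {n : ℕ} (X : Fin n → Bool) (t : ℕ) : ℕ :=
  (Finset.univ.filter fun i : Fin n => (i : ℕ) < t ∧ X i = true).card

/-- In every initial segment the numbers of labels `true` and `false` differ by at most `g`. -/
def IsBalanced {n : ℕ} (g : ℕ) (X : Fin n → Bool) : Prop :=
  ∀ t ≤ n, t ≤ 2 * prefixCount X t + g ∧ 2 * prefixCount X t ≤ t + g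

lemma card_filter_Ico {n : ℕ} (X : Fin n → Bool) {a b : ℕ} (hab : a ≤ b) :
    (Finset.univ.filter fun i : Fin n => a ≤ (i : ℕ) ∧ (i : ℕ) < b ∧ X i = true).card +
      prefixCount X a = prefixCount X b := by
  unfold prefixCount
  rw [← Finset.card_union_of_disjoint]
  · congr 1
    ext i
    simp only [Finset.mem_union, Finset.mem_filter, Finset.mem_univ, true_and]
    rcases h : X i
    · simp
    · simp only [and_true]
      omega
  · rw [Finset.disjoint_filter]
    intro i _ h h'
    omega

lemma card_filter_lt {n b : ℕ} (hb : b ≤ n) :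
    (Finset.univ.filter fun i : Fin n => (i : ℕ) < b).card = b := by
  rw [Fin.card_filter_val_lt, min_eq_right hb]

lemma card_filter_false {n : ℕ} (X : Fin n → Bool) {b : ℕ} (hb : b ≤ n) :
    (Finset.univ.filter fun i : Fin n => (i : ℕ) < b ∧ X i = false).card +
      prefixCount X b = b := by
  unfold prefixCount
  rw [← Finset.card_union_of_disjoint, ← Finset.filter_or]
  · conv_rhs => rw [← card_filter_lt hb]
    congr 1
    ext i
    rcases h : X i <;> simp [h]
  · rw [Finset.disjoint_filter]
    intro i _ h h'
    simp_all

lemma card_filter_add_card_filter_not {n : ℕ} (p : Fin n → Prop) [DecidablePred p] :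
    (Finset.univ.filter p).card + (Finset.univ.filter fun i => ¬ p i).card = n := by
  rw [Finset.card_filter_add_card_filter_not, Finset.card_univ, Fintype.card_fin]

/-- Clockwise from column `z` come the lower columns up to `z`, from right to left, then the upper
columns from left to right, then the remaining lower columns from right to left. This and the next
two lemmas compute the rank of a column in each of these three runs. -/
lemma card_colKey_lt_of_le {n : ℕ} {X : Fin n → Bool} {z c : Fin n} (hc : X c = true)
    (hcz : c ≤ z) :
    (Finset.univ.filter fun c' => colKey X z c' < colKey X z c).card +
      prefixCount X (c + 1) = prefixCount X (z + 1) := by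
  rw [← card_filter_Ico X (show (c : ℕ) + 1 ≤ z + 1 by simpa using hcz)]
  congr 2
  ext c'
  simp only [Finset.mem_filter, Finset.mem_univ, true_and, colKey, hc, hcz, if_true,
    Fin.le_def] at *
  rcases h : X c'
  · simp
  · simp only [and_true, if_true]
    split_ifs <;> omega

lemma card_colKey_lt_of_eq_false {n : ℕ} {X : Fin n → Bool} {z c : Fin n} (hc : X c = false) :
    (Finset.univ.filter fun c' => colKey X z c' < colKey X z c).card + prefixCount X c =
      prefixCount X (z + 1) + c := by
  have h₁ := card_filter_false X c.isLt.le
  have h₂ : (Finset.univ.filter fun c' => colKey X z c' < colKey X z c).card =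
      prefixCount X (z + 1) +
        (Finset.univ.filter fun i : Fin n => (i : ℕ) < c ∧ X i = false).card := by
    unfold prefixCount
    rw [← Finset.card_union_of_disjoint, ← Finset.filter_or]
    · congr 1
      ext c'
      have := c.isLt
      have h₀ : (c' : ℕ) = c → X c' = false := fun h => by rwa [Fin.ext h]
      simp only [Finset.mem_filter, Finset.mem_univ, true_and, colKey, hc, Fin.le_def]
      rcases h : X c' <;> simp only [h, and_true, if_true] at h₀ ⊢
      · simp
      · split_ifs <;> simp at * <;> omega
    · rw [Finset.disjoint_filter]
      intro i _ h h'
      simp_all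
  omega

lemma card_colKey_lt_of_gt {n : ℕ} {X : Fin n → Bool} {z c : Fin n} (hc : X c = true)
    (hcz : z < c) :
    (Finset.univ.filter fun c' => colKey X z c' < colKey X z c).card +
      prefixCount X (c + 1) = n + prefixCount X (z + 1) := by
  have h₁ := card_filter_Ico X (show (z : ℕ) + 1 ≤ c + 1 by simpa using hcz.le)
  have h₂ := card_filter_add_card_filter_not fun c' => colKey X z c' < colKey X z c
  have h₃ : (Finset.univ.filter fun c' => ¬ colKey X z c' < colKey X z c) =
      Finset.univ.filter fun i : Fin n =>
        (z : ℕ) + 1 ≤ (i : ℕ) ∧ (i : ℕ) < c + 1 ∧ X i = true := by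
    ext c'
    have := c.isLt
    have := c'.isLt
    simp only [Finset.mem_filter, Finset.mem_univ, true_and, colKey, hc, hcz.not_ge, if_true,
      Fin.le_def, if_false] at *
    rcases h : X c'
    · simp
      omega
    · simp only [and_true, if_true]
      split_ifs <;> omega
  rw [h₃] at h₂
  omega

lemma card_rowKey_lt_of_eq_true {n : ℕ} {Y : Fin n → Bool} {r : Fin n} (hr : Y r = true) :
    (Finset.univ.filter fun r' => rowKey Y r' < rowKey Y r).card = prefixCount Y r := by
  unfold prefixCount
  congr 1
  ext r'
  simp only [Finset.mem_filter, Finset.mem_univ, true_and, rowKey, hr, if_true]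
  by_cases h : Y r' = true <;> simp [h]
  omega

lemma card_rowKey_lt_of_eq_false {n : ℕ} {Y : Fin n → Bool} {r : Fin n} (hr : Y r = false) :
    (Finset.univ.filter fun r' => rowKey Y r' < rowKey Y r).card + (r + 1) =
      n + prefixCount Y (r + 1) := by
  have h₁ := card_filter_false Y (show (r : ℕ) + 1 ≤ n by omega)
  have h₂ := card_filter_add_card_filter_not fun r' => rowKey Y r' < rowKey Y r
  have h₃ : (Finset.univ.filter fun r' => ¬ rowKey Y r' < rowKey Y r) =
      Finset.univ.filter fun i : Fin n => (i : ℕ) < r + 1 ∧ Y i = false := by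
    ext r'
    simp only [Finset.mem_filter, Finset.mem_univ, true_and, rowKey, hr]
    rcases h : Y r' <;> simp
    all_goals omega
  rw [h₃] at h₂
  omega

lemma card_colKey_lt_eq {n : ℕ} (X Y : Fin n → Bool) (z c : Fin n) :
    (Finset.univ.filter fun c' => colKey X z c' < colKey X z c).card =
      (Finset.univ.filter fun r => rowKey Y r < rowKey Y (squareOf X Y z c)).card :=
  card_matchingPerm (colKey_injective X z) (rowKey_injective Y) c

lemma rowKey_squareOf_lt_iff {n : ℕ} (X Y : Fin n → Bool) (z c c' : Fin n) :
    rowKey Y (squareOf X Y z c) < rowKey Y (squareOf X Y z c') ↔ colKey X z c < colKey X z c' :=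
  matchingPerm_lt_iff (colKey_injective X z) (rowKey_injective Y) c c'

/-- For balanced labels the points of a square permutation lie close to the sides of a tilted
rectangle. -/
lemma squareOf_near_rectangle {n g : ℕ} {X Y : Fin n → Bool} (hX : IsBalanced g X)
    (hY : IsBalanced g Y) (z c : Fin n) :
    (X c = true → c ≤ z → (z : ℕ) ≤ c + squareOf X Y z c + 8 * (g + 1) ∧
      (c : ℕ) + squareOf X Y z c ≤ z + 8 * (g + 1)) ∧
    (X c = true → z < c → (c : ℕ) ≤ z + squareOf X Y z c + 8 * (g + 1) ∧
      (z : ℕ) + squareOf X Y z c ≤ c + 8 * (g + 1)) ∧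
    (X c = false → (squareOf X Y z c : ℕ) ≤ z + c + 8 * (g + 1) ∧
      (squareOf X Y z c : ℕ) + z + c ≤ 2 * n + 8 * (g + 1) ∧
      (Y (squareOf X Y z c) = true → (z : ℕ) + c ≤ squareOf X Y z c + 8 * (g + 1)) ∧
      (Y (squareOf X Y z c) = false → 2 * n ≤ squareOf X Y z c + z + c + 8 * (g + 1))) := by
  have hr := card_colKey_lt_eq X Y z c
  have hz := z.isLt
  have hc := c.isLt
  have hp := (squareOf X Y z c).isLt
  have x₁ := hX c hc.le
  have x₂ := hX (c + 1) hc
  have x₃ := hX (z + 1) hz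
  have y₁ := hY (squareOf X Y z c) hp.le
  have y₂ := hY (squareOf X Y z c + 1) hp
  -- Up to `O(g)`, the column rank is `(z-c)/2`, `n-(c-z)/2` or `(z+c)/2` in the three cases below,
  -- and the row rank is `r/2` on the left and `n-r/2` on the right. Equating them puts the point
  -- near a side; a lower column paired with the unexpected row label can occur only near a corner,
  -- within the same slack.
  have rows : (Y (squareOf X Y z c) = true ∧
      (Finset.univ.filter fun c' => colKey X z c' < colKey X z c).card =
        prefixCount Y (squareOf X Y z c)) ∨ (Y (squareOf X Y z c) = false ∧
      (Finset.univ.filter fun c' => colKey X z c' < colKey X z c).card +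
        (squareOf X Y z c + 1) = n + prefixCount Y (squareOf X Y z c + 1)) := by
    rcases hY' : Y (squareOf X Y z c)
    · right
      rw [hr, card_rowKey_lt_of_eq_false hY']
      simp
    · left
      rw [hr, card_rowKey_lt_of_eq_true hY']
      simp
  refine ⟨fun h h' => ?_, fun h h' => ?_, fun h => ?_⟩
  · have := card_colKey_lt_of_le h h'
    rw [Fin.le_def] at h'
    rcases rows with ⟨_, h₁⟩ | ⟨_, h₁⟩ <;> omega
  · have := card_colKey_lt_of_gt h h'
    rw [Fin.lt_def] at h'
    rcases rows with ⟨_, h₁⟩ | ⟨_, h₁⟩ <;> omega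
  · have := card_colKey_lt_of_eq_false (z := z) h
    rcases rows with ⟨h₀, h₁⟩ | ⟨h₀, h₁⟩ <;> simp only [h₀] <;>
      refine ⟨by omega, by omega, fun h₂ => ?_, fun h₂ => ?_⟩ <;> first | omega | simp at h₂

/-- The four sides of the square permutation with given balanced labels. -/
lemma squareOf_sides {n g : ℕ} {X Y : Fin n → Bool} (hX : IsBalanced g X)
    (hY : IsBalanced g Y) {z : Fin n} (hz : 8 * (g + 1) < (z : ℕ)) (hz' : z + 8 * (g + 1) < n)
    (c : Fin n) :
    ((c : ℕ) ≤ z ∧ X c = true ∧ colKey X z c = -(c : ℤ) ∧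
      rowKey Y (squareOf X Y z c) = (squareOf X Y z c : ℕ) ∧
      (z : ℕ) ≤ c + squareOf X Y z c + 8 * (g + 1) ∧
      (c : ℕ) + squareOf X Y z c ≤ z + 8 * (g + 1)) ∨
    ((z : ℕ) < c ∧ X c = true ∧ colKey X z c = 2 * n - (c : ℤ) ∧
      rowKey Y (squareOf X Y z c) = 2 * n - ((squareOf X Y z c : ℕ) : ℤ) ∧
      (c : ℕ) ≤ z + squareOf X Y z c + 8 * (g + 1) ∧
      (z : ℕ) + squareOf X Y z c ≤ c + 8 * (g + 1)) ∨
    (X c = false ∧ colKey X z c = (c : ℤ) ∧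
      rowKey Y (squareOf X Y z c) = (squareOf X Y z c : ℕ) ∧
      (squareOf X Y z c : ℕ) ≤ z + c + 8 * (g + 1) ∧
      (z : ℕ) + c ≤ squareOf X Y z c + 8 * (g + 1)) ∨
    (X c = false ∧ colKey X z c = (c : ℤ) ∧
      rowKey Y (squareOf X Y z c) = 2 * n - ((squareOf X Y z c : ℕ) : ℤ) ∧
      (squareOf X Y z c : ℕ) + z + c ≤ 2 * n + 8 * (g + 1) ∧
      2 * n ≤ squareOf X Y z c + z + c + 8 * (g + 1)) := by
  have hr := card_colKey_lt_eq X Y z c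
  obtain ⟨e₁, e₂, e₃⟩ := squareOf_near_rectangle hX hY z c
  have hc := c.isLt
  have hp := (squareOf X Y z c).isLt
  have x₂ := hX (c + 1) hc
  have x₃ := hX (z + 1) z.isLt
  have y₁ := hY (squareOf X Y z c) hp.le
  have y₂ := hY (squareOf X Y z c + 1) hp
  rcases hXc : X c
  · right; right
    obtain ⟨f₁, f₂, f₃, f₄⟩ := e₃ hXc
    rcases hY' : Y (squareOf X Y z c)
    · right
      exact ⟨rfl, by simp [colKey, hXc], by simp [rowKey, hY'], f₂, f₄ hY'⟩
    · left
      exact ⟨rfl, by simp [colKey, hXc], by simp [rowKey, hY'], f₁, f₃ hY'⟩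
  · by_cases hcz : c ≤ z
    · left
      obtain ⟨f₁, f₂⟩ := e₁ hXc hcz
      have hk := card_colKey_lt_of_le hXc hcz
      rw [Fin.le_def] at hcz
      have hY' : Y (squareOf X Y z c) = true := by
        by_contra hY'
        rw [Bool.not_eq_true] at hY'
        have := card_rowKey_lt_of_eq_false hY'
        omega
      exact ⟨hcz, rfl, by simp [colKey, hXc, Fin.le_def, hcz], by simp [rowKey, hY'], f₁, f₂⟩
    · right; left
      rw [not_le] at hcz
      obtain ⟨f₁, f₂⟩ := e₂ hXc hcz
      have hk := card_colKey_lt_of_gt hXc hcz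
      rw [Fin.lt_def] at hcz
      have hY' : Y (squareOf X Y z c) = false := by
        by_contra hY'
        rw [Bool.not_eq_false] at hY'
        have := card_rowKey_lt_of_eq_true hY'
        omega
      exact ⟨hcz, rfl, by simp [colKey, hXc, Fin.le_def, hcz.not_ge], by simp [rowKey, hY'],
        f₁, f₂⟩

/-- Each point is a record of the type of its side. On the same side the clockwise order decides; on
different sides the order and the position near the rectangle do. The margins on `z` separate
opposite sides by more than the slack. -/
lemma isExternal_squareOf {n g : ℕ} {X Y : Fin n → Bool} (hX : IsBalanced g X)
    (hY : IsBalanced g Y) {z : Fin n} (hz : 8 * (g + 1) < (z : ℕ)) (hz' : z + 8 * (g + 1) < n)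
    (c : Fin n) : IsExternal (squareOf X Y z) c := by
  have sides := squareOf_sides hX hY hz hz'
  have key := rowKey_squareOf_lt_iff X Y z
  generalize squareOf X Y z = π at sides key
  rcases sides c with ⟨a₁, a₂, e₁, e₂, a₃, a₄⟩ | ⟨a₁, a₂, e₁, e₂, a₃, a₄⟩ |
    ⟨a₂, e₁, e₂, a₃, a₄⟩ | ⟨a₂, e₁, e₂, a₃, a₄⟩
  · refine Or.inr (Or.inl fun j hj => ?_)
    have h₁ := key c j
    rw [Fin.lt_def] at hj ⊢
    have := j.isLt
    have := (π j).isLt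
    rcases sides j with ⟨b₁, b₂, d₁, d₂, b₃, b₄⟩ | ⟨b₁, b₂, d₁, d₂, b₃, b₄⟩ |
      ⟨b₂, d₁, d₂, b₃, b₄⟩ | ⟨b₂, d₁, d₂, b₃, b₄⟩ <;> rw [e₁, e₂, d₁, d₂] at h₁ <;> omega
  · refine Or.inr (Or.inr (Or.inr fun j hj => ?_))
    have h₁ := key j c
    rw [Fin.lt_def] at hj ⊢
    have := j.isLt
    have := (π j).isLt
    rcases sides j with ⟨b₁, b₂, d₁, d₂, b₃, b₄⟩ | ⟨b₁, b₂, d₁, d₂, b₃, b₄⟩ |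
      ⟨b₂, d₁, d₂, b₃, b₄⟩ | ⟨b₂, d₁, d₂, b₃, b₄⟩ <;> rw [e₁, e₂, d₁, d₂] at h₁ <;> omega
  · refine Or.inl fun j hj => ?_
    have h₁ := key j c
    have h₂ := key c j
    rw [Fin.lt_def] at hj ⊢
    have := j.isLt
    have := (π j).isLt
    have := (π c).isLt
    rcases sides j with ⟨b₁, b₂, d₁, d₂, b₃, b₄⟩ | ⟨b₁, b₂, d₁, d₂, b₃, b₄⟩ |
      ⟨b₂, d₁, d₂, b₃, b₄⟩ | ⟨b₂, d₁, d₂, b₃, b₄⟩ <;> rw [e₁, e₂, d₁, d₂] at h₁ h₂ <;> omega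
  · refine Or.inr (Or.inr (Or.inl fun j hj => ?_))
    have h₁ := key j c
    have h₂ := key c j
    rw [Fin.lt_def] at hj ⊢
    have := j.isLt
    have := (π j).isLt
    have := (π c).isLt
    rcases sides j with ⟨b₁, b₂, d₁, d₂, b₃, b₄⟩ | ⟨b₁, b₂, d₁, d₂, b₃, b₄⟩ |
      ⟨b₂, d₁, d₂, b₃, b₄⟩ | ⟨b₂, d₁, d₂, b₃, b₄⟩ <;> rw [e₁, e₂, d₁, d₂] at h₁ h₂ <;> omega

/-- Column `z` comes first among the columns and row `0` first among the rows. Hence `z` is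
recoverable from the permutation. -/
lemma squareOf_start {n : ℕ} {X Y : Fin n → Bool} {z : Fin n} (hY : EndsTrue Y)
    (hz : X z = true) : (squareOf X Y z z : ℕ) = 0 := by
  have hn : 0 < n := z.pos
  obtain ⟨c, hc⟩ := (squareOf X Y z).surjective ⟨0, hn⟩
  have hc' : (squareOf X Y z c : ℕ) = 0 := by rw [hc]
  by_cases h : c = z
  · rwa [h] at hc'
  exfalso
  have hlt : colKey X z z < colKey X z c := by
    refine lt_of_le_of_ne ?_ fun hk => h (colKey_injective X z hk).symm
    unfold colKey
    simp only [hz, le_refl, if_true, Fin.le_def]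
    split_ifs <;> omega
  rw [← rowKey_squareOf_lt_iff X Y, hc] at hlt
  have h₀ : rowKey Y ⟨0, hn⟩ = 0 := by simp [rowKey, hY ⟨0, hn⟩ (Or.inl rfl)]
  rw [h₀] at hlt
  unfold rowKey at hlt
  split_ifs at hlt <;> omega

/-- Columns `0` and `n - 1` are lower for both codes and serve as references. On the left half of
the boundary a point is lower or upper according as it is below or above the point in column `0`; on
the right half column `n - 1` plays this role. A disagreement that also switches halves contradicts
the position near the rectangle. -/
lemma squareOf_colLabels_le {n g : ℕ} {X Y X' Y' : Fin n → Bool} {z : Fin n}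
    (hX : IsBalanced g X) (hY : IsBalanced g Y) (hX' : IsBalanced g X') (hY' : IsBalanced g Y')
    (eX : EndsTrue X) (eX' : EndsTrue X')
    (hz : 8 * (g + 1) < (z : ℕ)) (hz' : z + 8 * (g + 1) < n)
    (h : squareOf X Y z = squareOf X' Y' z) {c : Fin n} (hc : X c = true) : X' c = true := by
  by_contra hc'
  rw [Bool.not_eq_true] at hc'
  have sides := squareOf_sides hX hY hz hz'
  have key := rowKey_squareOf_lt_iff X Y z
  have sides' := squareOf_sides hX' hY' hz hz'
  have key' := rowKey_squareOf_lt_iff X' Y' z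
  rw [← h] at sides' key'
  generalize squareOf X Y z = π at sides key sides' key'
  have hn : 0 < n := z.pos
  let o : Fin n := ⟨0, hn⟩
  let l : Fin n := ⟨n - 1, by omega⟩
  have hl : (l : ℕ) + 1 = n := by simp only [l]; omega
  have ho : (o : ℕ) = 0 := rfl
  have o₁ := sides o
  have o₂ := sides' o
  have l₁ := sides l
  have l₂ := sides' l
  have c₁ := sides c
  have c₂ := sides' c
  have ko := key c o
  have ko' := key' o c
  have kl := key l c
  have kl' := key' c l
  have h0 : (c : ℕ) ≠ 0 := fun h => by simp [eX' c (Or.inl h)] at hc'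
  have h1 : (c : ℕ) + 1 ≠ n := fun h => by simp [eX' c (Or.inr h)] at hc'
  have := c.isLt
  simp only [hc, hc', eX o (Or.inl ho), eX' o (Or.inl ho), eX l (Or.inr hl),
    eX' l (Or.inr hl), true_and, Bool.true_eq_false, Bool.false_eq_true, false_and, and_false,
    or_false, false_or] at o₁ o₂ l₁ l₂ c₁ c₂
  clear_value o l
  omega

/-- The highest row is labelled left in both codes. Any other row is left or right according as its
point comes before or after the highest point, and that order depends only on `X` and `z`. -/
lemma squareOf_rowLabels_le {n : ℕ} {X Y Y' : Fin n → Bool} {z : Fin n}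
    (eY : EndsTrue Y) (eY' : EndsTrue Y')
    (h : squareOf X Y z = squareOf X Y' z) {r : Fin n} (hr : Y r = true) : Y' r = true := by
  have hn : 0 < n := z.pos
  obtain ⟨c, rfl⟩ := (squareOf X Y z).surjective r
  obtain ⟨d, hd⟩ := (squareOf X Y z).surjective ⟨n - 1, by omega⟩
  have hd' : (squareOf X Y z d : ℕ) + 1 = n := by rw [hd]; simp; omega
  have key := rowKey_squareOf_lt_iff X Y z c d
  have key' := rowKey_squareOf_lt_iff X Y' z c d
  rw [← h] at key'
  by_contra hr'
  have hne : (squareOf X Y z c : ℕ) + 1 ≠ n := fun h => hr' (eY' _ (Or.inr h))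
  have := (squareOf X Y z c).isLt
  simp only [rowKey, hr, hr', eY _ (Or.inr hd'), eY' _ (Or.inr hd'), if_true] at key key'
  simp at key key'
  omega

/-- The labels can be read off from a square permutation, if they are balanced. -/
theorem squareOf_injective {n g : ℕ} {X Y X' Y' : Fin n → Bool} {z z' : Fin n}
    (hX : IsBalanced g X) (hY : IsBalanced g Y) (hX' : IsBalanced g X') (hY' : IsBalanced g Y')
    (eX : EndsTrue X) (eY : EndsTrue Y) (eX' : EndsTrue X') (eY' : EndsTrue Y')
    (hXz : X z = true) (hXz' : X' z' = true)
    (hz : 8 * (g + 1) < (z : ℕ)) (hz' : z + 8 * (g + 1) < n)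
    (h : squareOf X Y z = squareOf X' Y' z') : X = X' ∧ Y = Y' ∧ z = z' := by
  have h₁ := squareOf_start (X := X) eY hXz
  have h₂ := squareOf_start (X := X') eY' hXz'
  rw [← h] at h₂
  obtain rfl : z = z' := (squareOf X Y z).injective (Fin.ext (h₁.trans h₂.symm))
  obtain rfl : X = X' := by
    funext c
    exact Bool.eq_iff_iff.2 ⟨squareOf_colLabels_le hX hY hX' hY' eX eX' hz hz' h,
      squareOf_colLabels_le hX' hY' hX hY eX' eX hz hz' h.symm⟩
  refine ⟨rfl, ?_, rfl⟩
  funext r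
  exact Bool.eq_iff_iff.2 ⟨squareOf_rowLabels_le eY eY' h, squareOf_rowLabels_le eY' eY h.symm⟩

/-! ### Inner cells and the area of the rectangle -/

lemma IsBalanced.exists_true {n g : ℕ} {X : Fin n → Bool} (hX : IsBalanced g X) {t : ℕ}
    (ht : t + 2 * (g + 1) ≤ n) :
    ∃ i : Fin n, t ≤ (i : ℕ) ∧ (i : ℕ) < t + 2 * (g + 1) ∧ X i = true := by
  have h₁ := card_filter_Ico X (show t ≤ t + 2 * (g + 1) by omega)
  have h₂ := hX t (by omega)
  have h₃ := hX _ ht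
  obtain ⟨i, hi⟩ := Finset.card_pos.1 (show 0 < (Finset.univ.filter fun i : Fin n =>
    t ≤ (i : ℕ) ∧ (i : ℕ) < t + 2 * (g + 1) ∧ X i = true).card by omega)
  exact ⟨i, (Finset.mem_filter.1 hi).2⟩

lemma IsBalanced.exists_false {n g : ℕ} {X : Fin n → Bool} (hX : IsBalanced g X) {t : ℕ}
    (ht : t + 2 * (g + 1) ≤ n) :
    ∃ i : Fin n, t ≤ (i : ℕ) ∧ (i : ℕ) < t + 2 * (g + 1) ∧ X i = false := by
  by_contra! hno
  have h₁ := card_filter_false X (show t ≤ n by omega)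
  have h₂ := hX t (by omega)
  have h₃ := hX _ ht
  have h₄ := card_filter_false X ht
  have h₅ : (Finset.univ.filter fun i : Fin n => (i : ℕ) < t ∧ X i = false) =
      Finset.univ.filter fun i : Fin n => (i : ℕ) < t + 2 * (g + 1) ∧ X i = false := by
    refine Finset.filter_congr fun i _ => ⟨fun h => ⟨by omega, h.2⟩, fun h => ⟨?_, h.2⟩⟩
    by_contra h'
    exact hno i (by omega) h.1 h.2
  rw [h₅] at h₁
  omega

/-- Balance supplies a lower and an upper column just left of `a` and just right of it. Their points
are near the rectangle, so a cell at depth `16 * (g + 1)` inside it has them in its four quadrants.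
-/
lemma isInnerCell_squareOf {n g : ℕ} {X Y : Fin n → Bool} (hX : IsBalanced g X)
    (hY : IsBalanced g Y) {z : Fin n} {a b : ℕ} (h₁ : z + 16 * (g + 1) ≤ a + b)
    (h₂ : a + b + 16 * (g + 1) + z ≤ 2 * n) (h₃ : a + 16 * (g + 1) ≤ b + z)
    (h₄ : b + 16 * (g + 1) ≤ a + z) : IsInnerCell (squareOf X Y z) a b := by
  have near := squareOf_near_rectangle hX hY z
  generalize squareOf X Y z = π at near
  obtain ⟨i₁, p₁, q₁, r₁⟩ := hX.exists_true (t := a - 2 * (g + 1)) (by omega)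
  obtain ⟨i₂, p₂, q₂, r₂⟩ := hX.exists_false (t := a - 2 * (g + 1)) (by omega)
  obtain ⟨i₃, p₃, q₃, r₃⟩ := hX.exists_true (t := a) (by omega)
  obtain ⟨i₄, p₄, q₄, r₄⟩ := hX.exists_false (t := a) (by omega)
  refine ⟨⟨i₁, by omega, ?_⟩, ⟨i₂, by omega, ?_⟩, ⟨i₃, by omega, ?_⟩, ⟨i₄, by omega, ?_⟩⟩
  · obtain ⟨e₁, e₂, -⟩ := near i₁
    rcases le_or_gt i₁ z with h | h
    · have := e₁ r₁ h
      omega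
    · have := e₂ r₁ h
      omega
  · obtain ⟨-, -, e₃⟩ := near i₂
    obtain ⟨-, -, e₄, e₅⟩ := e₃ r₂
    rcases h : Y (π i₂)
    · have := e₅ h
      omega
    · have := e₄ h
      omega
  · obtain ⟨e₁, e₂, -⟩ := near i₃
    rcases le_or_gt i₃ z with h | h
    · have := e₁ r₃ h
      omega
    · have := e₂ r₃ h
      omega
  · obtain ⟨-, -, e₃⟩ := near i₄
    obtain ⟨-, -, e₄, e₅⟩ := e₃ r₄
    rcases h : Y (π i₄)
    · have := e₅ h
      omega
    · have := e₄ h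
      omega

lemma le_card_innerCells_squareOf {n g : ℕ} {X Y : Fin n → Bool} (hX : IsBalanced g X)
    (hY : IsBalanced g Y) (z : Fin n) :
    2 * ((n - z - 32 * (g + 1)) * (z - 32 * (g + 1))) ≤ (innerCells (squareOf X Y z)).card := by
  have hcard : ((Finset.range (n - z - 32 * (g + 1)) ×ˢ Finset.range (z - 32 * (g + 1))) ×ˢ
      Finset.range 2).card = 2 * ((n - z - 32 * (g + 1)) * (z - 32 * (g + 1))) := by
    simp only [Finset.card_product, Finset.card_range]
    ring
  rw [← hcard]
  -- Coordinates along the two directions of the rectangle. The vectors `(1,1)` and `(1,-1)` span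
  -- only half of the lattice; the bit `e` selects the coset and gives the factor 2.
  refine Finset.card_le_card_of_injOn (fun p =>
    (Fin.ofNat (n + 1) (p.1.1 + p.1.2 + 32 * (g + 1) + p.2),
      Fin.ofNat (n + 1) (z + p.1.1 - p.1.2))) ?_ ?_
  · rintro ⟨⟨s, t⟩, e⟩ h
    simp only [Finset.coe_product, Finset.coe_range, Set.mem_prod, Set.mem_Iio] at h
    simp only [innerCells, Finset.coe_filter, Finset.mem_univ, true_and, Set.mem_ofPred_eq,
      Fin.val_ofNat]
    rw [Nat.mod_eq_of_lt (by omega), Nat.mod_eq_of_lt (by omega)]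
    exact isInnerCell_squareOf hX hY (by omega) (by omega) (by omega) (by omega)
  · rintro ⟨⟨s, t⟩, e⟩ h ⟨⟨s', t'⟩, e'⟩ h' heq
    simp only [Finset.coe_product, Finset.coe_range, Set.mem_prod, Set.mem_Iio] at h h'
    simp only [Prod.mk.injEq, Fin.ext_iff, Fin.val_ofNat] at heq
    rw [Nat.mod_eq_of_lt (by omega), Nat.mod_eq_of_lt (by omega), Nat.mod_eq_of_lt (by omega),
      Nat.mod_eq_of_lt (by omega)] at heq
    simp only [Prod.mk.injEq]
    omega

/-- All points satisfy the four relaxed inequalities of the rectangle. The occupied quadrant facing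
each side transfers that side's inequality to the cell. -/
lemma innerCell_squareOf_bounds {n g : ℕ} {X Y : Fin n → Bool} (hX : IsBalanced g X)
    (hY : IsBalanced g Y) {z : Fin n} {a b : ℕ} (h : IsInnerCell (squareOf X Y z) a b) :
    z ≤ a + b + 16 * (g + 1) ∧ a + b + z ≤ 2 * n + 16 * (g + 1) ∧ a ≤ b + z + 16 * (g + 1) ∧
      b ≤ a + z + 16 * (g + 1) := by
  have near := squareOf_near_rectangle hX hY z
  generalize squareOf X Y z = π at near h
  have pts : ∀ c : Fin n, (z : ℕ) ≤ c + π c + 16 * (g + 1) ∧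
      (c : ℕ) + π c + z ≤ 2 * n + 16 * (g + 1) ∧ (c : ℕ) ≤ π c + z + 16 * (g + 1) ∧
      (π c : ℕ) ≤ c + z + 16 * (g + 1) := by
    intro c
    have := c.isLt
    have := z.isLt
    have := (π c).isLt
    obtain ⟨e₁, e₂, e₃⟩ := near c
    rcases hc : X c
    · obtain ⟨f₁, f₂, f₃, f₄⟩ := e₃ hc
      rcases h : Y (π c)
      · have := f₄ h
        omega
      · have := f₃ h
        omega
    · rcases le_or_gt c z with h | h
      · have := e₁ hc h
        rw [Fin.le_def] at h
        omega
      · have := e₂ hc h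
        rw [Fin.lt_def] at h
        omega
  obtain ⟨⟨i₁, p₁, q₁⟩, ⟨i₂, p₂, q₂⟩, ⟨i₃, p₃, q₃⟩, ⟨i₄, p₄, q₄⟩⟩ := h
  have := pts i₁
  have := pts i₂
  have := pts i₃
  have := pts i₄
  omega

lemma card_innerCells_squareOf_le {n g : ℕ} {X Y : Fin n → Bool} (hX : IsBalanced g X)
    (hY : IsBalanced g Y) (z : Fin n) :
    (innerCells (squareOf X Y z)).card ≤
      (2 * (n - z) + 32 * (g + 1) + 1) * (z + 16 * (g + 1) + 1) := by
  rw [← Finset.card_range (2 * (n - z) + 32 * (g + 1) + 1),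
    ← Finset.card_range (z + 16 * (g + 1) + 1), ← Finset.card_product]
  -- Halving the second coordinate loses nothing, since `a - b` has the parity of `a + b`.
  refine Finset.card_le_card_of_injOn (fun p => ((p.1 : ℕ) + p.2 + 16 * (g + 1) - z,
    ((p.1 : ℕ) + z + 16 * (g + 1) - p.2) / 2)) ?_ ?_
  · rintro ⟨a, b⟩ h
    simp only [innerCells, Finset.coe_filter, Finset.mem_univ, true_and,
      Set.mem_ofPred_eq] at h
    have := innerCell_squareOf_bounds hX hY h
    have := z.isLt
    simp only [Finset.coe_product, Finset.coe_range, Set.mem_prod, Set.mem_Iio]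
    omega
  · rintro ⟨a, b⟩ h ⟨a', b'⟩ h' heq
    simp only [innerCells, Finset.coe_filter, Finset.mem_univ, true_and,
      Set.mem_ofPred_eq] at h h'
    have := innerCell_squareOf_bounds hX hY h
    have := innerCell_squareOf_bounds hX hY h'
    simp only [Prod.mk.injEq, Fin.ext_iff] at heq ⊢
    omega

/-- The number of inner cells of a balanced square permutation is close to the area of a tilted
rectangle. -/
lemma card_innerCells_squareOf_le_area {n g : ℕ} {X Y : Fin n → Bool} (hX : IsBalanced g X)
    (hY : IsBalanced g Y) (z : Fin n) (hg : g + 1 ≤ n) :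
    ((innerCells (squareOf X Y z)).card : ℝ) ≤ 2 * z * (n - 1 - z) + 1000 * (g + 1) * n := by
  have h := card_innerCells_squareOf_le hX hY z
  have hz := z.isLt
  have h' : ((innerCells (squareOf X Y z)).card : ℝ) ≤
      (2 * (n - z) + 32 * (g + 1) + 1) * (z + 16 * (g + 1) + 1) := by
    have := Nat.cast_le (α := ℝ).2 h
    push_cast [Nat.cast_sub hz.le] at this
    exact this
  have hg' : ((g : ℝ) + 1) ≤ n := by exact_mod_cast hg
  have hz' : ((z : ℕ) : ℝ) ≤ n := by exact_mod_cast hz.le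
  have hz0 : (0 : ℝ) ≤ ((z : ℕ) : ℝ) := by positivity
  have hg0 : (0 : ℝ) ≤ (g : ℝ) := by positivity
  have e₁ : ((g : ℝ) + 1) * (g + 1) ≤ (g + 1) * n := by gcongr
  have e₂ : ((g : ℝ) + 1) * z ≤ (g + 1) * n := by gcongr
  have e₃ : (1 : ℝ) * n ≤ (g + 1) * n := by gcongr; linarith
  nlinarith

/-- If `z` is within `32 * (g + 1)` of an end, the left side is nonpositive. Otherwise the lattice
count applies. -/
lemma area_le_card_innerCells_squareOf {n g : ℕ} {X Y : Fin n → Bool} (hX : IsBalanced g X)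
    (hY : IsBalanced g Y) (z : Fin n) :
    2 * z * (n - 1 - z) - 1000 * (g + 1) * n ≤ ((innerCells (squareOf X Y z)).card : ℝ) := by
  have hz := z.isLt
  have hz' : ((z : ℕ) : ℝ) ≤ n := by exact_mod_cast hz.le
  have hz0 : (0 : ℝ) ≤ ((z : ℕ) : ℝ) := by positivity
  have hg0 : (0 : ℝ) ≤ (g : ℝ) := by positivity
  have hzn : 0 ≤ (n : ℝ) - z := by linarith
  rcases le_or_gt (32 * (g + 1)) (z : ℕ) with h₁ | h₁
  · rcases le_or_gt (32 * (g + 1)) (n - z) with h₂ | h₂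
    · have h := le_card_innerCells_squareOf hX hY z
      have := Nat.cast_le (α := ℝ).2 h
      push_cast [Nat.cast_sub hz.le, Nat.cast_sub h₁, Nat.cast_sub h₂] at this
      refine le_trans ?_ this
      have e₂ : ((g : ℝ) + 1) * z ≤ (g + 1) * n := by gcongr
      nlinarith
    · refine le_trans ?_ (Nat.cast_nonneg _)
      have h₃ : (n : ℝ) ≤ z + 32 * (g + 1) := by
        have : n ≤ z + 32 * (g + 1) := by omega
        exact_mod_cast this
      have e₁ : (z : ℝ) * (n - 1 - z) ≤ n * (32 * (g + 1)) := by
        refine (mul_le_mul_of_nonneg_left (show (n : ℝ) - 1 - z ≤ 32 * (g + 1) by linarith)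
          hz0).trans ?_
        gcongr
      nlinarith [mul_nonneg (by linarith : 0 ≤ (g : ℝ) + 1) (Nat.cast_nonneg (α := ℝ) n)]
  · refine le_trans ?_ (Nat.cast_nonneg _)
    have h₃ : ((z : ℕ) : ℝ) ≤ 32 * (g + 1) := by exact_mod_cast h₁.le
    have e₁ : (z : ℝ) * (n - z) ≤ (32 * (g + 1)) * n := by
      gcongr
      linarith
    nlinarith [mul_nonneg (by linarith : 0 ≤ (g : ℝ) + 1) (Nat.cast_nonneg (α := ℝ) n)]

lemma card_innerCells_le {m : ℕ} (σ : Equiv.Perm (Fin m)) :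
    (innerCells σ).card ≤ (m + 1) * (m + 1) := by
  refine (Finset.card_le_univ _).trans ?_
  simp

/-! ### Concentration of random labels -/

/-- The moment generating function factors over positions, with `cosh l ≤ exp (l ^ 2 / 2)` up to `t`
and a trivial factor afterwards. -/
lemma sum_exp_prefixCount_le {n : ℕ} (l : ℝ) {t : ℕ} (ht : t ≤ n) :
    ∑ X : Fin n → Bool, Real.exp (l * (2 * prefixCount X t - t)) ≤
      2 ^ n * Real.exp (n * (l ^ 2 / 2)) := by
  let w : Fin n → Bool → ℝ := fun i b => if (i : ℕ) < t then (if b then 1 else -1) else 0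
  have hs : ∀ X : Fin n → Bool, (2 * prefixCount X t - t : ℝ) = ∑ i, w i (X i) := by
    intro X
    have h₁ := card_filter_lt ht
    have h₂ : ∀ i, w i (X i) = 2 * (if (i : ℕ) < t ∧ X i = true then (1 : ℝ) else 0) -
        (if (i : ℕ) < t then (1 : ℝ) else 0) := by
      intro i
      simp only [w]
      rcases X i <;> split_ifs <;> simp_all
      norm_num
    rw [Finset.sum_congr rfl fun i _ => h₂ i, Finset.sum_sub_distrib, ← Finset.mul_sum,
      Finset.sum_boole, Finset.sum_boole, h₁, prefixCount]
  calc ∑ X : Fin n → Bool, Real.exp (l * (2 * prefixCount X t - t))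
      = ∑ X : Fin n → Bool, ∏ i, Real.exp (l * w i (X i)) := by
        refine Finset.sum_congr rfl fun X _ => ?_
        rw [hs, Finset.mul_sum, Real.exp_sum]
    _ = ∏ i, ∑ b, Real.exp (l * w i b) := by
        rw [Finset.prod_univ_sum, Fintype.piFinset_univ]
    _ ≤ ∏ _i : Fin n, 2 * Real.exp (l ^ 2 / 2) := by
        refine Finset.prod_le_prod (fun i _ => by positivity) fun i _ => ?_
        rw [Fintype.sum_bool]
        by_cases hi : (i : ℕ) < t
        · have := Real.cosh_le_exp_half_sq l
          rw [Real.cosh_eq] at this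
          simp only [w, hi, if_true, mul_one]
          simp
          linarith
        · have : (1 : ℝ) ≤ Real.exp (l ^ 2 / 2) := Real.one_le_exp (by positivity)
          simp only [w, hi, if_false, mul_zero, Real.exp_zero]
          linarith
    _ = _ := by
        rw [Finset.prod_const, Finset.card_univ, Fintype.card_fin, mul_pow, ← Real.exp_nat_mul]

lemma card_filter_le_of_le_mul {n g : ℕ} (hn : 0 < n) {t : ℕ} (ht : t ≤ n) {s : ℝ}
    (hs : s ^ 2 = 1) (p : (Fin n → Bool) → Prop) [DecidablePred p]
    (hp : ∀ X, p X → (g : ℝ) ≤ s * (2 * prefixCount X t - t)) :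
    ((Finset.univ.filter p).card : ℝ) ≤ 2 ^ n * Real.exp (-(g ^ 2 / (2 * n))) := by
  have hn' : (0 : ℝ) < n := by exact_mod_cast hn
  -- The exponent `g / n` optimizes the Chernoff bound; the sign `s` selects the tail.
  have h := sum_exp_prefixCount_le (n := n) (g / n * s) ht
  have h₁ : ((Finset.univ.filter p).card : ℝ) * Real.exp (g / n * g) ≤
      ∑ X : Fin n → Bool, Real.exp (g / n * s * (2 * prefixCount X t - t)) := by
    rw [← nsmul_eq_mul, ← Finset.sum_const]
    refine le_trans (Finset.sum_le_sum fun X hX => ?_) (Finset.sum_le_sum_of_subset_of_nonneg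
      (Finset.subset_univ _) fun X _ _ => (Real.exp_pos _).le)
    rw [Real.exp_le_exp, mul_assoc]
    exact mul_le_mul_of_nonneg_left (hp X (Finset.mem_filter.1 hX).2) (by positivity)
  have h₂ := h₁.trans h
  rw [← le_div_iff₀ (Real.exp_pos _), mul_div_assoc, ← Real.exp_sub] at h₂
  refine h₂.trans (le_of_eq ?_)
  congr 2
  rw [mul_pow, hs]
  field_simp
  ring

/-- All but exponentially few label sequences are balanced. -/
lemma card_not_isBalanced_le {n g : ℕ} (hn : 0 < n) [DecidablePred (IsBalanced (n := n) g)] :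
    ((Finset.univ.filter fun X : Fin n → Bool => ¬ IsBalanced g X).card : ℝ) ≤
      2 * (n + 1) * 2 ^ n * Real.exp (-(g ^ 2 / (2 * n))) := by
  classical
  have hsub : (Finset.univ.filter fun X : Fin n → Bool => ¬ IsBalanced g X) ⊆
      (Finset.range (n + 1)).biUnion fun t =>
        (Finset.univ.filter fun X : Fin n → Bool => 2 * prefixCount X t + g < t) ∪
          (Finset.univ.filter fun X : Fin n → Bool => t + g < 2 * prefixCount X t) := by
    intro X hX
    simp only [Finset.mem_filter, Finset.mem_univ, true_and, IsBalanced, not_forall,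
      not_and_or, not_le] at hX
    obtain ⟨t, ht, hX⟩ := hX
    simp only [Finset.mem_biUnion, Finset.mem_range, Finset.mem_union, Finset.mem_filter,
      Finset.mem_univ, true_and]
    exact ⟨t, by omega, hX⟩
  have hcard := (Finset.card_le_card hsub).trans Finset.card_biUnion_le
  have hcard' : ((Finset.univ.filter fun X : Fin n → Bool => ¬ IsBalanced g X).card : ℝ) ≤
      ∑ _t ∈ Finset.range (n + 1), 2 * (2 ^ n * Real.exp (-(g ^ 2 / (2 * n)))) := by
    refine le_trans (Nat.cast_le.2 hcard) ?_
    rw [Nat.cast_sum]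
    refine Finset.sum_le_sum fun t ht => ?_
    have ht' : t ≤ n := by
      rw [Finset.mem_range] at ht
      omega
    refine le_trans (Nat.cast_le.2 (Finset.card_union_le _ _)) ?_
    rw [Nat.cast_add, two_mul]
    refine add_le_add (card_filter_le_of_le_mul hn ht' (s := -1) (by norm_num) _ fun X hX => ?_)
      (card_filter_le_of_le_mul hn ht' (s := 1) (by norm_num) _ fun X hX => ?_)
    · have : ((2 * prefixCount X t + g : ℕ) : ℝ) ≤ t := by exact_mod_cast hX.le
      push_cast at this
      linarith
    · have : ((t + g : ℕ) : ℝ) ≤ (2 * prefixCount X t : ℕ) := by exact_mod_cast hX.le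
      push_cast at this
      linarith
  refine hcard'.trans (le_of_eq ?_)
  rw [Finset.sum_const, Finset.card_range, nsmul_eq_mul]
  push_cast
  ring

/-! ### Sums over square permutations through their codes -/

lemma card_filter_eq_true {n : ℕ} (S : Finset (Fin n)) :
    (Finset.univ.filter fun X : Fin n → Bool => ∀ i ∈ S, X i = true).card * 2 ^ S.card =
      2 ^ n := by
  have h : (Finset.univ.filter fun X : Fin n → Bool => ∀ i ∈ S, X i = true) =
      Fintype.piFinset fun i => if i ∈ S then {true} else Finset.univ := by
    ext X
    simp only [Finset.mem_filter, Finset.mem_univ, true_and, Fintype.mem_piFinset]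
    refine forall_congr' fun i => ?_
    split_ifs with hi <;> simp [hi]
  have h₂ : ∀ i : Fin n, (if i ∈ S then ({true} : Finset Bool) else Finset.univ).card =
      if i ∈ S then 1 else 2 := by
    intro i
    split_ifs <;> simp
  have h₃ : (2 : ℕ) ^ S.card = ∏ i, if i ∈ S then 2 else 1 := by
    rw [Finset.prod_ite_mem, Finset.univ_inter, Finset.prod_const]
  rw [h, Fintype.card_piFinset, Finset.prod_congr rfl fun i _ => h₂ i, h₃,
    ← Finset.prod_mul_distrib]
  have h₄ : ∀ i : Fin n, (if i ∈ S then 1 else 2) * (if i ∈ S then 2 else 1) = 2 := by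
    intro i
    split_ifs <;> rfl
  rw [Finset.prod_congr rfl fun i _ => h₄ i, Finset.prod_const, Finset.card_univ,
    Fintype.card_fin]

/-- The label sequences that are `true` at both ends. -/
def endLabels (n : ℕ) : Finset (Fin n → Bool) :=
  {X | EndsTrue X}

/-- The label sequences that are `true` at both ends and at `z`. -/
def anchoredLabels {n : ℕ} (z : Fin n) : Finset (Fin n → Bool) :=
  {X | EndsTrue X ∧ X z = true}

lemma card_ends {n : ℕ} (hn : 2 ≤ n) :
    (Finset.univ.filter fun i : Fin n => (i : ℕ) = 0 ∨ (i : ℕ) + 1 = n).card = 2 := by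
  have : (Finset.univ.filter fun i : Fin n => (i : ℕ) = 0 ∨ (i : ℕ) + 1 = n) =
      {⟨0, by omega⟩, ⟨n - 1, by omega⟩} := by
    ext i
    simp only [Finset.mem_filter, Finset.mem_univ, true_and, Finset.mem_insert,
      Finset.mem_singleton, Fin.ext_iff]
    omega
  rw [this, Finset.card_pair]
  simp only [ne_eq, Fin.ext_iff]
  omega

lemma card_endLabels {n : ℕ} (hn : 2 ≤ n) : (endLabels n).card * 4 = 2 ^ n := by
  have h := card_filter_eq_true (Finset.univ.filter fun i : Fin n => (i : ℕ) = 0 ∨ (i : ℕ) + 1 = n)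
  rw [card_ends hn] at h
  simpa [endLabels, EndsTrue] using h

lemma card_anchoredLabels_of_end {n : ℕ} (hn : 2 ≤ n) {z : Fin n}
    (hz : (z : ℕ) = 0 ∨ (z : ℕ) + 1 = n) : (anchoredLabels z).card * 4 = 2 ^ n := by
  rw [← card_endLabels hn]
  congr 2
  ext X
  simp only [anchoredLabels, endLabels, Finset.mem_filter, Finset.mem_univ, true_and,
    and_iff_left_iff_imp]
  exact fun h => h z hz

lemma card_anchoredLabels_of_not_end {n : ℕ} (hn : 2 ≤ n) {z : Fin n}
    (hz : ¬ ((z : ℕ) = 0 ∨ (z : ℕ) + 1 = n)) : (anchoredLabels z).card * 8 = 2 ^ n := by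
  have h := card_filter_eq_true
    (insert z (Finset.univ.filter fun i : Fin n => (i : ℕ) = 0 ∨ (i : ℕ) + 1 = n))
  rw [Finset.card_insert_of_notMem (by simpa using hz), card_ends hn] at h
  rw [← h]
  congr 2
  ext X
  simp only [anchoredLabels, Finset.mem_filter, Finset.mem_univ, true_and,
    Finset.mem_insert, forall_eq_or_imp]
  exact and_comm

lemma mem_ASq_zero {n : ℕ} {π : Equiv.Perm (Fin n)} :
    π ∈ ASq n 0 ↔ ∀ i, IsExternal π i := by
  refine mem_ASq.trans ?_
  change (externalPoints π).card = n ↔ _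
  have h := Finset.card_eq_iff_eq_univ (externalPoints π)
  rw [Fintype.card_fin] at h
  rw [h, externalPoints, Finset.filter_eq_self]
  simp

/-- A sum over square permutations is at most the sum over their encodings. -/
lemma sum_ASq_zero_le_sum_squareOf {n : ℕ} (hn : 0 < n) (f : Equiv.Perm (Fin n) → ℝ)
    (hf : ∀ π, 0 ≤ f π) :
    ∑ π ∈ ASq n 0, f π ≤
      ∑ z : Fin n, ∑ X ∈ anchoredLabels z, ∑ Y ∈ endLabels n, f (squareOf X Y z) := by
  classical
  have hsub : ASq n 0 ⊆ ((Finset.univ : Finset (Fin n)).sigma fun z =>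
      anchoredLabels z ×ˢ endLabels n).image fun p => squareOf p.2.1 p.2.2 p.1 := by
    intro π hπ
    obtain ⟨X, Y, z, hX, hY, hz, rfl⟩ := exists_eq_squareOf hn (mem_ASq_zero.1 hπ)
    refine Finset.mem_image.2 ⟨⟨z, X, Y⟩, ?_, rfl⟩
    simp [anchoredLabels, endLabels, hX, hY, hz]
  refine (Finset.sum_le_sum_of_subset_of_nonneg hsub fun π _ _ => hf π).trans ?_
  refine (Finset.sum_image_le_of_nonneg fun p _ => hf _).trans (le_of_eq ?_)
  rw [Finset.sum_sigma]
  refine Finset.sum_congr rfl fun z _ => ?_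
  rw [Finset.sum_product]

/-- A sum over square permutations is at least the sum over balanced encodings whose lowest
column is away from both ends. -/
lemma sum_squareOf_le_sum_ASq_zero {n g : ℕ} [DecidablePred (IsBalanced (n := n) g)]
    (f : Equiv.Perm (Fin n) → ℝ) (hf : ∀ π, 0 ≤ f π) (S : Finset (Fin n))
    (hS : ∀ z ∈ S, 8 * (g + 1) < (z : ℕ) ∧ z + 8 * (g + 1) < n) :
    ∑ z ∈ S, ∑ X ∈ (anchoredLabels z).filter (IsBalanced g),
      ∑ Y ∈ (endLabels n).filter (IsBalanced g), f (squareOf X Y z) ≤ ∑ π ∈ ASq n 0, f π := by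
  classical
  have h : ∑ z ∈ S, ∑ X ∈ (anchoredLabels z).filter (IsBalanced g),
      ∑ Y ∈ (endLabels n).filter (IsBalanced g), f (squareOf X Y z) =
      ∑ p ∈ S.sigma fun z => (anchoredLabels z).filter (IsBalanced g) ×ˢ
        (endLabels n).filter (IsBalanced g), f (squareOf p.2.1 p.2.2 p.1) := by
    rw [Finset.sum_sigma]
    refine Finset.sum_congr rfl fun z _ => ?_
    rw [Finset.sum_product]
  rw [h, ← Finset.sum_image (f := f) (g := fun p : (_ : Fin n) × ((Fin n → Bool) × (Fin n → Bool))
    => squareOf p.2.1 p.2.2 p.1)]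
  · refine Finset.sum_le_sum_of_subset_of_nonneg ?_ fun π _ _ => hf π
    intro π hπ
    obtain ⟨⟨z, X, Y⟩, hp, rfl⟩ := Finset.mem_image.1 hπ
    simp only [Finset.mem_sigma, Finset.mem_product, Finset.mem_filter] at hp
    exact mem_ASq_zero.2 (isExternal_squareOf hp.2.1.2 hp.2.2.2 (hS z hp.1).1 (hS z hp.1).2)
  · rintro ⟨z, X, Y⟩ hp ⟨z', X', Y'⟩ hp' heq
    simp only [Finset.mem_coe, Finset.mem_sigma, Finset.mem_product, Finset.mem_filter,
      anchoredLabels, endLabels, Finset.mem_univ, true_and] at hp hp'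
    obtain ⟨h₁, h₂, h₃⟩ := squareOf_injective hp.2.1.2 hp.2.2.2 hp'.2.1.2 hp'.2.2.2 hp.2.1.1.1
      hp.2.2.1 hp'.2.1.1.1 hp'.2.2.1 hp.2.1.1.2 hp'.2.1.1.2 (hS z hp.1).1 (hS z hp.1).2 heq
    rw [h₁, h₂, h₃]

/-- Source of the constant: three prescribed column labels and two prescribed row labels cost `2 ^
5`. When `z` is an end, one prescription is redundant. -/
lemma card_anchoredLabels_mul_card_endLabels {n : ℕ} (hn : 2 ≤ n) (z : Fin n) :
    32 * (((anchoredLabels z).card : ℝ) * (endLabels n).card) =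
      4 ^ n * (if (z : ℕ) = 0 ∨ (z : ℕ) + 1 = n then 2 else 1) := by
  have h₁ : ((endLabels n).card : ℝ) * 4 = 2 ^ n := by exact_mod_cast card_endLabels hn
  have h₃ : (4 : ℝ) ^ n = 2 ^ n * 2 ^ n := by rw [← mul_pow]; norm_num
  rw [h₃]
  split_ifs with hz
  · have h₂ : ((anchoredLabels z).card : ℝ) * 4 = 2 ^ n := by
      exact_mod_cast card_anchoredLabels_of_end hn hz
    rw [← h₂]
    rw [← h₂] at h₁
    linear_combination (2 * ((anchoredLabels z).card : ℝ) * 4) * h₁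
  · have h₂ : ((anchoredLabels z).card : ℝ) * 8 = 2 ^ n := by
      exact_mod_cast card_anchoredLabels_of_not_end hn hz
    rw [← h₂]
    rw [← h₂] at h₁
    linear_combination (((anchoredLabels z).card : ℝ) * 8) * h₁

lemma card_endLabels_le {n : ℕ} : ((endLabels n).card : ℝ) ≤ 2 ^ n := by
  have : (endLabels n).card ≤ 2 ^ n := by
    refine (Finset.card_le_univ _).trans ?_
    simp
  exact_mod_cast this

lemma card_anchoredLabels_le {n : ℕ} (z : Fin n) : ((anchoredLabels z).card : ℝ) ≤ 2 ^ n := by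
  have : (anchoredLabels z).card ≤ 2 ^ n := by
    refine (Finset.card_le_univ _).trans ?_
    simp
  exact_mod_cast this

/-- Balanced codes contribute at most the area bound; the rare others are charged the trivial bound
`(n + 1) ^ 2` on the number of cells. -/
lemma sum_squareOf_le_of_anchored {n g : ℕ} (hn : 0 < n) (hg : g + 1 ≤ n) (k : ℕ) {E : ℝ}
    (hE : 0 ≤ E) (z : Fin n) :
    ∑ X ∈ anchoredLabels z, ∑ Y ∈ endLabels n, ((innerCells (squareOf X Y z)).card + E) ^ k ≤
      ((anchoredLabels z).card * (endLabels n).card : ℝ) *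
          (2 * z * (n - 1 - z) + 1000 * (g + 1) * n + E) ^ k +
        4 * (n + 1) * 4 ^ n * Real.exp (-(g ^ 2 / (2 * n))) * ((n + 1) ^ 2 + E) ^ k := by
  classical
  set f : ℝ := (2 * z * (n - 1 - z) + 1000 * (g + 1) * n + E) ^ k
  set M : ℝ := ((n + 1) ^ 2 + E) ^ k
  have hM : 0 ≤ M := by positivity
  have hf : 0 ≤ f := by
    have : ((z : ℕ) : ℝ) + 1 ≤ n := by exact_mod_cast z.isLt
    have : 0 ≤ 2 * (z : ℝ) * (n - 1 - z) := mul_nonneg (by positivity) (by linarith)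
    positivity
  have hb := card_not_isBalanced_le (g := g) hn
  set b : ℝ := ((Finset.univ.filter fun X : Fin n → Bool => ¬ IsBalanced g X).card : ℝ)
  have hle : ∀ X Y : Fin n → Bool, ((innerCells (squareOf X Y z)).card + E) ^ k ≤
      f + ((if ¬ IsBalanced g X then M else 0) + if ¬ IsBalanced g Y then M else 0) := by
    intro X Y
    have hall : ((innerCells (squareOf X Y z)).card + E) ^ k ≤ M := by
      have : ((innerCells (squareOf X Y z)).card : ℝ) ≤ (n + 1) * (n + 1) := by
        exact_mod_cast card_innerCells_le _
      refine pow_le_pow_left₀ (by positivity) ?_ k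
      linarith [sq ((n : ℝ) + 1)]
    by_cases hX : IsBalanced g X
    · by_cases hY : IsBalanced g Y
      · simp only [hX, hY, not_true_eq_false, if_false, add_zero]
        refine pow_le_pow_left₀ (by positivity) ?_ k
        linarith [card_innerCells_squareOf_le_area hX hY z hg]
      · simp only [hX, hY, not_true_eq_false, not_false_eq_true, if_false, if_true]
        linarith
    · simp only [hX, not_false_eq_true, if_true]
      split_ifs <;> linarith
  have hsub : ∀ A : Finset (Fin n → Bool), ∑ X ∈ A, (if ¬ IsBalanced g X then M else 0) ≤
      b * M := by
    intro A
    rw [← Finset.sum_filter, Finset.sum_const, nsmul_eq_mul]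
    refine mul_le_mul_of_nonneg_right (Nat.cast_le.2 (Finset.card_le_card ?_)) hM
    exact Finset.filter_subset_filter _ (Finset.subset_univ _)
  have h4 : (4 : ℝ) ^ n = 2 ^ n * 2 ^ n := by rw [← mul_pow]; norm_num
  calc ∑ X ∈ anchoredLabels z, ∑ Y ∈ endLabels n, ((innerCells (squareOf X Y z)).card + E) ^ k
      ≤ ∑ X ∈ anchoredLabels z, ∑ Y ∈ endLabels n,
          (f + ((if ¬ IsBalanced g X then M else 0) + if ¬ IsBalanced g Y then M else 0)) :=
        Finset.sum_le_sum fun X _ => Finset.sum_le_sum fun Y _ => hle X Y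
    _ = ((anchoredLabels z).card * (endLabels n).card : ℝ) * f +
          ((endLabels n).card * (∑ X ∈ anchoredLabels z, if ¬ IsBalanced g X then M else 0) +
          (anchoredLabels z).card * ∑ Y ∈ endLabels n, if ¬ IsBalanced g Y then M else 0) := by
        simp only [Finset.sum_add_distrib, Finset.sum_const, nsmul_eq_mul, Finset.mul_sum]
        ring
    _ ≤ ((anchoredLabels z).card * (endLabels n).card : ℝ) * f +
          (2 ^ n * (b * M) + 2 ^ n * (b * M)) := by
        have := hsub (anchoredLabels z)
        have := hsub (endLabels n)
        gcongr
        · exact card_endLabels_le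
        · exact card_anchoredLabels_le z
    _ ≤ _ := by
        have h₁ : (2 : ℝ) ^ n * (b * M) ≤
            2 ^ n * ((2 * (n + 1) * 2 ^ n * Real.exp (-(g ^ 2 / (2 * n)))) * M) := by gcongr
        rw [h4]
        linarith

/-- Upper bound for power sums of the number of inner cells over square permutations. -/
lemma sum_ASq_zero_pow_le {n g : ℕ} (hn : 2 ≤ n) (hg : g + 1 ≤ n) (k : ℕ) {E : ℝ} (hE : 0 ≤ E) :
    32 * ∑ π ∈ ASq n 0, ((innerCells π).card + E) ^ k ≤
      4 ^ n * (∑ z : Fin n, (if (z : ℕ) = 0 ∨ (z : ℕ) + 1 = n then 2 else 1) *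
          (2 * z * (n - 1 - z) + 1000 * (g + 1) * n + E) ^ k +
        128 * n * (n + 1) * Real.exp (-(g ^ 2 / (2 * n))) * ((n + 1) ^ 2 + E) ^ k) := by
  have h₁ := sum_ASq_zero_le_sum_squareOf (by omega : 0 < n)
    (fun π => ((innerCells π).card + E) ^ k) fun π => by positivity
  have h₂ := h₁.trans (Finset.sum_le_sum fun z _ =>
    sum_squareOf_le_of_anchored (by omega) hg k hE z)
  refine (mul_le_mul_of_nonneg_left h₂ (by norm_num)).trans (le_of_eq ?_)
  rw [Finset.sum_add_distrib, Finset.sum_const, Finset.card_univ, Fintype.card_fin, nsmul_eq_mul,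
    mul_add 32, mul_add (4 ^ n : ℝ), Finset.mul_sum, Finset.mul_sum]
  congr 1
  · refine Finset.sum_congr rfl fun z _ => ?_
    rw [← mul_assoc, card_anchoredLabels_mul_card_endLabels hn z, mul_assoc]
  · ring

/-- Lower bound for power sums of the number of inner cells over square permutations. -/
lemma le_sum_ASq_zero_pow {n g : ℕ} (hn : 2 ≤ n) (k : ℕ) (S : Finset (Fin n))
    (hS : ∀ z ∈ S, 8 * (g + 1) < (z : ℕ) ∧ z + 8 * (g + 1) < n ∧
      0 ≤ 2 * (z : ℝ) * (n - 1 - z) - 1000 * (g + 1) * n) :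
    4 ^ n * ((1 - 128 * (n + 1) * Real.exp (-(g ^ 2 / (2 * n)))) *
      ∑ z ∈ S, (2 * (z : ℝ) * (n - 1 - z) - 1000 * (g + 1) * n) ^ k) ≤
      32 * ∑ π ∈ ASq n 0, ((innerCells π).card : ℝ) ^ k := by
  classical
  have h₁ := sum_squareOf_le_sum_ASq_zero (g := g)
    (fun π => ((innerCells π).card : ℝ) ^ k) (fun π => by positivity) S
    fun z hz => ⟨(hS z hz).1, (hS z hz).2.1⟩
  refine le_trans ?_ (mul_le_mul_of_nonneg_left h₁ (by norm_num))
  rw [Finset.mul_sum, Finset.mul_sum, Finset.mul_sum]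
  refine Finset.sum_le_sum fun z hz => ?_
  have hpos : 0 ≤ (2 * (z : ℝ) * (n - 1 - z) - 1000 * (g + 1) * n) ^ k :=
    pow_nonneg (hS z hz).2.2 k
  have h₂ : ((((anchoredLabels z).filter (IsBalanced g)).card : ℝ) *
      ((endLabels n).filter (IsBalanced g)).card) *
      (2 * (z : ℝ) * (n - 1 - z) - 1000 * (g + 1) * n) ^ k ≤
      ∑ X ∈ (anchoredLabels z).filter (IsBalanced g),
      ∑ Y ∈ (endLabels n).filter (IsBalanced g), ((innerCells (squareOf X Y z)).card : ℝ) ^ k := by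
    rw [mul_assoc, ← nsmul_eq_mul, ← nsmul_eq_mul, ← Finset.sum_const, ← Finset.sum_const]
    refine Finset.sum_le_sum fun X hX => Finset.sum_le_sum fun Y hY => ?_
    exact pow_le_pow_left₀ (hS z hz).2.2 (area_le_card_innerCells_squareOf
      (Finset.mem_filter.1 hX).2 (Finset.mem_filter.1 hY).2 z) k
  refine le_trans ?_ (mul_le_mul_of_nonneg_left h₂ (by norm_num))
  rw [← mul_assoc, ← mul_assoc]
  refine mul_le_mul_of_nonneg_right ?_ hpos
  have hb := card_not_isBalanced_le (g := g) (by omega : 0 < n)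
  set b : ℝ := ((Finset.univ.filter fun X : Fin n → Bool => ¬ IsBalanced g X).card : ℝ)
  have split : ∀ A : Finset (Fin n → Bool), ∃ c : ℝ, 0 ≤ c ∧ c ≤ b ∧
      ((A.filter (IsBalanced g)).card : ℝ) = A.card - c := by
    intro A
    refine ⟨((A.filter fun X => ¬ IsBalanced g X).card : ℝ), by positivity, ?_, ?_⟩
    · exact Nat.cast_le.2 (Finset.card_le_card
        (Finset.filter_subset_filter _ (Finset.subset_univ _)))
    · have := Finset.card_filter_add_card_filter_not (s := A) (IsBalanced g)
      rw [← this]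
      push_cast
      ring
  obtain ⟨c, hc₀, hc, hA⟩ := split (anchoredLabels z)
  obtain ⟨d, hd₀, hd, hB⟩ := split (endLabels n)
  rw [hA, hB]
  have hw := card_anchoredLabels_mul_card_endLabels hn z
  have hw' : (4 : ℝ) ^ n ≤ 32 * (((anchoredLabels z).card : ℝ) * (endLabels n).card) := by
    rw [hw]
    have : (0 : ℝ) < 4 ^ n := by positivity
    split_ifs <;> linarith
  -- Removing the unbalanced sequences from either factor of the product loses at most `2 ^ n * b`.
  -- Twice this, multiplied by 32, is the error in the statement.
  have e₁ : c * (endLabels n).card ≤ b * 2 ^ n := by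
    gcongr
    exact card_endLabels_le
  have e₂ : (anchoredLabels z).card * d ≤ 2 ^ n * b := by
    gcongr
    exact card_anchoredLabels_le z
  have e₃ : 0 ≤ c * d := by positivity
  have h4 : (4 : ℝ) ^ n = 2 ^ n * 2 ^ n := by rw [← mul_pow]; norm_num
  have e₄ := mul_le_mul_of_nonneg_left hb (by positivity : (0 : ℝ) ≤ 2 ^ n)
  have e₅ : (4 : ℝ) ^ n * (1 - 128 * (n + 1) * Real.exp (-(g ^ 2 / (2 * n)))) =
      4 ^ n - 64 * (2 ^ n * (2 * (n + 1) * 2 ^ n * Real.exp (-(g ^ 2 / (2 * n))))) := by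
    rw [h4]; ring
  rw [e₅]
  linarith

/-! ### Moments of the area -/

/-- Coefficient comparison in `(1-x)^(-(k+1)) * (1-x)^(-(k+1)) = (1-x)^(-(2k+2))`; a discrete Beta
integral. -/
lemma sum_antidiagonal_choose_mul_choose (k N : ℕ) :
    ∑ p ∈ Finset.HasAntidiagonal.antidiagonal N, (k + p.1).choose k * (k + p.2).choose k =
      (N + 2 * k + 1).choose (2 * k + 1) := by
  have h := congrArg (fun u : (PowerSeries ℤ)ˣ => PowerSeries.coeff N (u : PowerSeries ℤ))
    (PowerSeries.invOneSubPow_add ℤ (k + 1) (k + 1))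
  rw [show k + 1 + (k + 1) = 2 * k + 1 + 1 by ring] at h
  simp only [Units.val_mul, PowerSeries.invOneSubPow_val_succ_eq_mk_add_choose,
    PowerSeries.coeff_mul, PowerSeries.coeff_mk] at h
  rw [show N + 2 * k + 1 = 2 * k + 1 + N by ring]
  exact_mod_cast h.symm

/-- The `k`-th moment of the area of a tilted rectangle inscribed in the unit square. -/
noncomputable def areaMoment (k : ℕ) : ℝ :=
  2 ^ k * (k.factorial : ℝ) ^ 2 / ((2 * k + 1).factorial : ℝ)

lemma areaMoment_pos (k : ℕ) : 0 < areaMoment k := by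
  unfold areaMoment
  positivity

/-- The ratio of consecutive moments is `(k + 1) / (2k + 3)`, which is at least `1/3`. -/
lemma areaMoment_le_succ (k : ℕ) : areaMoment k ≤ 3 * areaMoment (k + 1) := by
  unfold areaMoment
  rw [show 2 * (k + 1) + 1 = 2 * k + 1 + 1 + 1 by ring, Nat.factorial_succ (2 * k + 1 + 1),
    Nat.factorial_succ (2 * k + 1), Nat.factorial_succ k, mul_div_assoc', div_le_div_iff₀
    (by positivity) (by positivity)]
  push_cast
  have : (0 : ℝ) ≤ 2 ^ k * (k.factorial : ℝ) ^ 2 * ((2 * k + 1).factorial : ℝ) *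
    ((k + 1) * (2 * k)) := by positivity
  rw [← sub_nonneg]
  refine this.trans (le_of_eq ?_)
  ring

lemma areaMoment_le_add (k j : ℕ) : areaMoment k ≤ 3 ^ j * areaMoment (k + j) := by
  induction j with
  | zero => simp
  | succ j ih =>
    refine ih.trans ?_
    rw [pow_succ, mul_assoc]
    exact mul_le_mul_of_nonneg_left (areaMoment_le_succ _) (by positivity)

lemma one_le_areaMoment (k : ℕ) : 1 ≤ 3 ^ k * areaMoment k := by
  have := areaMoment_le_add 0 k
  simpa [areaMoment] using this

lemma sum_range_area_pow {n : ℕ} (hn : 0 < n) (k : ℕ) :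
    ∑ z ∈ Finset.range n, (2 * (z : ℝ) * (n - 1 - z)) ^ k =
      2 ^ k * ((∑ p ∈ Finset.HasAntidiagonal.antidiagonal (n - 1), (p.1 * p.2) ^ k : ℕ) : ℝ) := by
  obtain ⟨m, rfl⟩ : ∃ m, n = m + 1 := ⟨n - 1, by omega⟩
  rw [Nat.add_sub_cancel, Finset.Nat.sum_antidiagonal_eq_sum_range_succ_mk, Nat.cast_sum,
    Finset.mul_sum]
  refine Finset.sum_congr rfl fun z hz => ?_
  rw [Finset.mem_range] at hz
  push_cast [Nat.cast_sub (show z ≤ m by omega)]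
  rw [mul_assoc, mul_pow]
  ring

/-- Powers are bounded by rising factorials, whose convolution is exact. -/
lemma sum_range_area_pow_le {n : ℕ} (hn : 0 < n) (k : ℕ) :
    ∑ z ∈ Finset.range n, (2 * (z : ℝ) * (n - 1 - z)) ^ k ≤
      areaMoment k * (n + 2 * k) ^ (2 * k + 1) := by
  rw [sum_range_area_pow hn]
  have h₀ : ∀ m : ℕ, m ^ k ≤ k.factorial * (k + m).choose k := by
    intro m
    have := Nat.pow_succ_le_ascFactorial (m + 1) k
    rw [← add_comm m k, ← Nat.ascFactorial_eq_factorial_mul_choose]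
    exact le_trans (Nat.pow_le_pow_left (Nat.le_succ m) k) this
  have h₁ : ∑ p ∈ Finset.HasAntidiagonal.antidiagonal (n - 1), (p.1 * p.2) ^ k ≤
      k.factorial ^ 2 * (n + 2 * k).choose (2 * k + 1) := by
    rw [show n + 2 * k = n - 1 + 2 * k + 1 by omega, ← sum_antidiagonal_choose_mul_choose,
      Finset.mul_sum]
    refine Finset.sum_le_sum fun p _ => ?_
    rw [mul_pow, sq, mul_mul_mul_comm]
    exact Nat.mul_le_mul (h₀ _) (h₀ _)
  have h₂ : (2 * k + 1).factorial * (n + 2 * k).choose (2 * k + 1) ≤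
      (n + 2 * k) ^ (2 * k + 1) := by
    rw [← Nat.descFactorial_eq_factorial_mul_choose]
    exact Nat.descFactorial_le_pow _ _
  have h₂' : ((2 * k + 1).factorial : ℝ) * ((n + 2 * k).choose (2 * k + 1) : ℕ) ≤
      (n + 2 * k) ^ (2 * k + 1) := by exact_mod_cast h₂
  have h₁' := Nat.cast_le (α := ℝ).2 h₁
  refine (mul_le_mul_of_nonneg_left h₁' (by positivity)).trans ?_
  rw [areaMoment, div_mul_eq_mul_div, le_div_iff₀ (by positivity)]
  push_cast
  calc (2 : ℝ) ^ k * ((k.factorial : ℝ) ^ 2 * ((n + 2 * k).choose (2 * k + 1) : ℕ)) *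
        ((2 * k + 1).factorial : ℝ)
      = 2 ^ k * (k.factorial : ℝ) ^ 2 *
        (((2 * k + 1).factorial : ℝ) * ((n + 2 * k).choose (2 * k + 1) : ℕ)) := by ring
    _ ≤ _ := mul_le_mul_of_nonneg_left h₂' (by positivity)

/-- Here `(m + k) ^ k` dominates the rising factorial, so the exact convolution is applied with both
coordinates shifted by `k`; hence `n - 2k`. -/
lemma le_sum_range_area_pow {n k : ℕ} (hn : 2 * k < n) :
    areaMoment k * (n - 2 * k) ^ (2 * k + 1) ≤
      ∑ z ∈ Finset.range n, (2 * (z : ℝ) * (n - 1 - z)) ^ k := by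
  rw [sum_range_area_pow (by omega)]
  have h₀ : ∀ m : ℕ, k.factorial * (k + m).choose k ≤ (m + k) ^ k := by
    intro m
    rw [← Nat.descFactorial_eq_factorial_mul_choose, add_comm]
    exact Nat.descFactorial_le_pow _ _
  have h₁ : k.factorial ^ 2 * n.choose (2 * k + 1) ≤
      ∑ p ∈ Finset.HasAntidiagonal.antidiagonal (n - 1), (p.1 * p.2) ^ k := by
    have : n = n - 1 - 2 * k + 2 * k + 1 := by omega
    calc k.factorial ^ 2 * n.choose (2 * k + 1)
        = k.factorial ^ 2 * (n - 1 - 2 * k + 2 * k + 1).choose (2 * k + 1) := by rw [← this]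
      _ ≤ ∑ p ∈ Finset.HasAntidiagonal.antidiagonal (n - 1 - 2 * k), ((p.1 + k) * (p.2 + k)) ^ k := by
          rw [← sum_antidiagonal_choose_mul_choose, Finset.mul_sum]
          refine Finset.sum_le_sum fun p _ => ?_
          rw [mul_pow, sq, mul_mul_mul_comm]
          exact Nat.mul_le_mul (h₀ _) (h₀ _)
      _ = ∑ p ∈ (Finset.HasAntidiagonal.antidiagonal (n - 1 - 2 * k)).image fun p => (p.1 + k, p.2 + k),
            (p.1 * p.2) ^ k := by
          rw [Finset.sum_image]
          rintro ⟨a, b⟩ _ ⟨c, d⟩ _ h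
          simpa using h
      _ ≤ _ := by
          refine Finset.sum_le_sum_of_subset fun p hp => ?_
          obtain ⟨q, hq, rfl⟩ := Finset.mem_image.1 hp
          rw [Finset.HasAntidiagonal.mem_antidiagonal] at hq ⊢
          simp only
          omega
  have h₂ : (n - 2 * k) ^ (2 * k + 1) ≤ (2 * k + 1).factorial * n.choose (2 * k + 1) := by
    rw [← Nat.descFactorial_eq_factorial_mul_choose]
    have := Nat.pow_sub_le_descFactorial n (2 * k + 1)
    rwa [Nat.add_sub_add_right] at this
  have h₂' : ((n : ℝ) - 2 * k) ^ (2 * k + 1) ≤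
      ((2 * k + 1).factorial : ℝ) * (n.choose (2 * k + 1) : ℕ) := by
    have := Nat.cast_le (α := ℝ).2 h₂
    push_cast [Nat.cast_sub hn.le] at this
    exact this
  have h₁' := Nat.cast_le (α := ℝ).2 h₁
  refine le_trans ?_ (mul_le_mul_of_nonneg_left h₁' (by positivity))
  rw [areaMoment, div_mul_eq_mul_div, div_le_iff₀ (by positivity)]
  push_cast
  calc 2 ^ k * (k.factorial : ℝ) ^ 2 * ((n : ℝ) - 2 * k) ^ (2 * k + 1)
      ≤ 2 ^ k * (k.factorial : ℝ) ^ 2 *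
        (((2 * k + 1).factorial : ℝ) * (n.choose (2 * k + 1) : ℕ)) :=
        mul_le_mul_of_nonneg_left h₂' (by positivity)
    _ = _ := by ring

lemma area_nonneg {n z : ℕ} (hz : z < n) : 0 ≤ 2 * (z : ℝ) * (n - 1 - z) := by
  have : ((z : ℕ) : ℝ) + 1 ≤ n := by exact_mod_cast hz
  exact mul_nonneg (by positivity) (by linarith)

/-- Perturbation of the upper bound by a small amount `q * n ^ 2` of area. -/
lemma sum_range_area_add_pow_le {n : ℕ} (hn : 0 < n) (k : ℕ) {q : ℝ} (hq : 0 ≤ q) :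
    ∑ z ∈ Finset.range n, (2 * (z : ℝ) * (n - 1 - z) + q * n ^ 2) ^ k ≤
      areaMoment k * (n + 2 * k) ^ (2 * k + 1) * (1 + 3 * q) ^ k := by
  calc ∑ z ∈ Finset.range n, (2 * (z : ℝ) * (n - 1 - z) + q * n ^ 2) ^ k
      = ∑ i ∈ Finset.range (k + 1), (∑ z ∈ Finset.range n, (2 * (z : ℝ) * (n - 1 - z)) ^ i) *
          (q * n ^ 2) ^ (k - i) * k.choose i := by
        simp_rw [add_pow]
        rw [Finset.sum_comm]
        simp_rw [Finset.sum_mul]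
    -- Replacing the moment of order `i` by that of order `k` costs `3 ^ (k - i)`, so the binomial
    -- sum closes up again with `3 * q`.
    _ ≤ ∑ i ∈ Finset.range (k + 1), areaMoment k * (n + 2 * k) ^ (2 * k + 1) *
          (1 ^ i * (3 * q) ^ (k - i) * k.choose i) := by
        refine Finset.sum_le_sum fun i hi => ?_
        obtain ⟨j, rfl⟩ : ∃ j, k = i + j := ⟨k - i, by
          rw [Finset.mem_range] at hi
          omega⟩
        rw [Nat.add_sub_cancel_left, one_pow, one_mul]
        calc (∑ z ∈ Finset.range n, (2 * (z : ℝ) * (n - 1 - z)) ^ i) *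
              (q * n ^ 2) ^ j * (i + j).choose i
            ≤ (3 ^ j * areaMoment (i + j) * (n + 2 * (i + j : ℕ)) ^ (2 * i + 1)) *
              (q ^ j * (n + 2 * (i + j : ℕ)) ^ (2 * j)) * (i + j).choose i := by
              have h₁ := sum_range_area_pow_le hn i
              have h₂ := areaMoment_le_add i j
              have h₃ := (areaMoment_pos i).le
              have h₄ := (areaMoment_pos (i + j)).le
              gcongr
              · refine h₁.trans ?_
                push_cast
                gcongr
                linarith [Nat.cast_nonneg (α := ℝ) j]
              · rw [mul_pow, ← pow_mul]
                gcongr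
                push_cast
                linarith [Nat.cast_nonneg (α := ℝ) j, Nat.cast_nonneg (α := ℝ) i]
          _ = _ := by
              rw [show 2 * (i + j) + 1 = 2 * i + 1 + 2 * j by ring, pow_add _ (2 * i + 1), mul_pow]
              ring
    _ = _ := by rw [← Finset.mul_sum, ← add_pow]

/-- The two extreme terms of the sum have the least area, so doubling them matters little. -/
lemma sum_weight_mul_le {n : ℕ} (hn : 2 ≤ n) (k : ℕ) {D : ℝ} (hD : 0 ≤ D) :
    ∑ z ∈ Finset.range n, (if z = 0 ∨ z + 1 = n then 2 else 1) *
        (2 * (z : ℝ) * (n - 1 - z) + D) ^ k ≤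
      (1 + 2 / n) * ∑ z ∈ Finset.range n, (2 * (z : ℝ) * (n - 1 - z) + D) ^ k := by
  have hn' : (0 : ℝ) < n := by positivity
  have h₁ : (n : ℝ) * D ^ k ≤ ∑ z ∈ Finset.range n, (2 * (z : ℝ) * (n - 1 - z) + D) ^ k := by
    have : (n : ℝ) * D ^ k = ∑ _z ∈ Finset.range n, D ^ k := by simp
    rw [this]
    refine Finset.sum_le_sum fun z hz => pow_le_pow_left₀ hD ?_ k
    linarith [area_nonneg (Finset.mem_range.1 hz)]
  have h₂ : ∑ z ∈ Finset.range n, (if z = 0 ∨ z + 1 = n then 2 else 1) *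
        (2 * (z : ℝ) * (n - 1 - z) + D) ^ k =
      ∑ z ∈ Finset.range n, (2 * (z : ℝ) * (n - 1 - z) + D) ^ k + 2 * D ^ k := by
    have h₃ : ∀ z ∈ Finset.range n, (if z = 0 ∨ z + 1 = n then 2 else 1) *
        (2 * (z : ℝ) * (n - 1 - z) + D) ^ k = (2 * (z : ℝ) * (n - 1 - z) + D) ^ k +
          ((if z = 0 then D ^ k else 0) + if z = n - 1 then D ^ k else 0) := by
      intro z hz
      rw [Finset.mem_range] at hz
      by_cases h0 : z = 0
      · subst h0
        rw [if_pos (Or.inl rfl), if_pos rfl, if_neg (by omega)]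
        simp only [Nat.cast_zero, mul_zero, zero_mul, zero_add]
        ring
      · by_cases h1 : z + 1 = n
        · rw [if_pos (Or.inr h1), if_neg h0, if_pos (by omega)]
          have : (n : ℝ) - 1 - z = 0 := by
            rw [← h1]
            push_cast
            ring
          rw [this]
          simp only [mul_zero, zero_add]
          ring
        · rw [if_neg (by omega), if_neg h0, if_neg (by omega)]
          ring
    rw [Finset.sum_congr rfl h₃, Finset.sum_add_distrib, Finset.sum_add_distrib,
      Finset.sum_ite_eq', Finset.sum_ite_eq', if_pos (Finset.mem_range.2 (by omega)),
      if_pos (Finset.mem_range.2 (by omega))]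
    ring
  rw [h₂, add_mul, one_mul]
  have : D ^ k ≤ (∑ z ∈ Finset.range n, (2 * (z : ℝ) * (n - 1 - z) + D) ^ k) / n := by
    rw [le_div_iff₀ hn']
    linarith
  have h₄ : 2 / (n : ℝ) * ∑ z ∈ Finset.range n, (2 * (z : ℝ) * (n - 1 - z) + D) ^ k =
    2 * ((∑ z ∈ Finset.range n, (2 * (z : ℝ) * (n - 1 - z) + D) ^ k) / n) := by ring
  rw [h₄]
  linarith

/-! ### Choice of scales and the two bounds -/

/-- With `g` about `c * n` the tail is at most `exp (-2bn)`. One factor `exp (-bn)` absorbs the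
polynomial, and the other is kept to beat exponentials in `k`. -/
lemma exists_fluctuation_scale {η : ℝ} (hη : 0 < η) :
    ∃ b > 0, ∀ᶠ n : ℕ in atTop, ∃ g : ℕ, 1000 * ((g : ℝ) + 1) ≤ η ^ 2 * n ∧
      128 * ((n : ℝ) + 1) * Real.exp (-(g ^ 2 / (2 * n))) ≤ η * Real.exp (-(b * n)) := by
  set c : ℝ := η ^ 2 / 2000 with hc
  have hc0 : 0 < c := by positivity
  set b : ℝ := c ^ 2 / 4 with hb
  have hb0 : 0 < b := by positivity
  have hlim : Tendsto (fun n : ℕ => 128 * ((n : ℝ) + 1) * Real.exp (-(b * n))) atTop (nhds 0) := by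
    have h₁ : Tendsto (fun x : ℝ => x * Real.exp (-(b * x))) atTop (nhds 0) := by
      have := Real.tendsto_pow_mul_exp_neg_atTop_nhds_zero 1
      have h₂ := (this.comp (tendsto_id.const_mul_atTop hb0)).const_mul (1 / b)
      simp only [mul_zero] at h₂
      refine h₂.congr fun x => ?_
      simp only [Function.comp_apply, id, pow_one]
      field_simp
    have h₂ : Tendsto (fun x : ℝ => Real.exp (-(b * x))) atTop (nhds 0) :=
      Real.tendsto_exp_atBot.comp
        (tendsto_neg_atTop_atBot.comp (tendsto_id.const_mul_atTop hb0))
    have h₃ := ((h₁.add h₂).const_mul 128).comp tendsto_natCast_atTop_atTop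
    simp only [add_zero, mul_zero] at h₃
    refine h₃.congr fun n => ?_
    simp only [Function.comp_apply]
    ring
  refine ⟨b, hb0, ?_⟩
  filter_upwards [hlim.eventually (gt_mem_nhds hη), eventually_gt_atTop 0,
    tendsto_natCast_atTop_atTop.eventually (eventually_ge_atTop (4000 / η ^ 2))] with n h₁ h₂ h₃
  have hn : (0 : ℝ) < n := by exact_mod_cast h₂
  refine ⟨⌈c * n⌉₊, ?_, ?_⟩
  · have h₄ := (Nat.ceil_lt_add_one (show 0 ≤ c * n by positivity)).le
    rw [div_le_iff₀ (by positivity)] at h₃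
    rw [hc] at h₄
    rw [hc]
    linarith
  · have h₄ := Nat.le_ceil (c * n)
    have h₅ : Real.exp (-((⌈c * n⌉₊ : ℝ) ^ 2 / (2 * n))) ≤
        Real.exp (-(b * n)) * Real.exp (-(b * n)) := by
      rw [← Real.exp_add, Real.exp_le_exp]
      have : (c * n) ^ 2 / (2 * n) ≤ (⌈c * n⌉₊ : ℝ) ^ 2 / (2 * n) := by gcongr
      have h₆ : (c * n) ^ 2 / (2 * n) = b * n + b * n := by
        rw [hb]
        field_simp
        ring
      linarith
    calc 128 * ((n : ℝ) + 1) * Real.exp (-((⌈c * n⌉₊ : ℝ) ^ 2 / (2 * n)))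
        ≤ 128 * ((n : ℝ) + 1) * (Real.exp (-(b * n)) * Real.exp (-(b * n))) := by gcongr
      _ = 128 * ((n : ℝ) + 1) * Real.exp (-(b * n)) * Real.exp (-(b * n)) := by ring
      _ ≤ _ := by gcongr

lemma add_one_pow_le_exp {x : ℝ} (hx : 0 ≤ x) (k : ℕ) : (1 + x) ^ k ≤ Real.exp (k * x) := by
  rw [Real.exp_nat_mul]
  refine pow_le_pow_left₀ (by positivity) ?_ k
  linarith [Real.add_one_le_exp x]

/-- The end weights cost `exp (η k)`, replacing `n + 2k` by `n` another `exp (η k)`, and the area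
error `exp (6 η k)`. -/
lemma sum_weight_mul_area_pow_le {η D : ℝ} (hη : 0 < η) (hη1 : η ≤ 1) {n k : ℕ} (hk : 0 < k)
    (hkn : 36 * (k : ℝ) ≤ η * n) (hD0 : 0 ≤ D) (hD : D ≤ 2 * η * n ^ 2) :
    ∑ z : Fin n, (if (z : ℕ) = 0 ∨ (z : ℕ) + 1 = n then 2 else 1) *
      (2 * (z : ℝ) * (n - 1 - z) + D) ^ k ≤
      areaMoment k * n ^ (2 * k + 1) * Real.exp (8 * η * k) := by
  have hk1 : (1 : ℝ) ≤ k := by exact_mod_cast hk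
  have hn0 : (0 : ℝ) ≤ n := by positivity
  have hηn : η * n ≤ n := by nlinarith
  have hn36 : (36 : ℝ) ≤ n := by linarith
  have hn : 2 ≤ n := by
    have : (2 : ℝ) ≤ n := by linarith
    exact_mod_cast this
  have hI := areaMoment_pos k
  rw [Fin.sum_univ_eq_sum_range (fun z => (if z = 0 ∨ z + 1 = n then 2 else 1) *
    (2 * (z : ℝ) * (n - 1 - z) + D) ^ k)]
  calc ∑ z ∈ Finset.range n, (if z = 0 ∨ z + 1 = n then 2 else 1) *
        (2 * (z : ℝ) * (n - 1 - z) + D) ^ k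
      ≤ ∑ z ∈ Finset.range n, (if z = 0 ∨ z + 1 = n then 2 else 1) *
        (2 * (z : ℝ) * (n - 1 - z) + 2 * η * n ^ 2) ^ k := by
        refine Finset.sum_le_sum fun z hz => mul_le_mul_of_nonneg_left ?_
          (by split_ifs <;> norm_num)
        have := area_nonneg (Finset.mem_range.1 hz)
        refine pow_le_pow_left₀ (by positivity) ?_ k
        linarith
    _ ≤ (1 + 2 / n) * ∑ z ∈ Finset.range n, (2 * (z : ℝ) * (n - 1 - z) + 2 * η * n ^ 2) ^ k :=
        sum_weight_mul_le hn k (by positivity)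
    _ ≤ (1 + 2 / n) * (areaMoment k * (n + 2 * k) ^ (2 * k + 1) * (1 + 3 * (2 * η)) ^ k) := by
        gcongr
        exact sum_range_area_add_pow_le (by omega) k (by positivity)
    _ ≤ Real.exp (η * k) * (areaMoment k * (n ^ (2 * k + 1) * Real.exp (η * k)) *
          Real.exp (6 * η * k)) := by
        have e₁ : 1 + 2 / (n : ℝ) ≤ Real.exp (η * k) := by
          have : 2 / (n : ℝ) ≤ η * k := by
            rw [div_le_iff₀ (by linarith)]
            nlinarith
          linarith [Real.add_one_le_exp (η * k)]
        have e₂ : ((n : ℝ) + 2 * k) ^ (2 * k + 1) ≤ n ^ (2 * k + 1) * Real.exp (η * k) := by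
          have e₃ : ((n : ℝ) + 2 * k) = n * (1 + 2 * k / n) := by
            field_simp
          have e₄ : 2 * (k : ℝ) / n ≤ η / 18 := by
            rw [div_le_iff₀ (by linarith)]
            linarith
          rw [e₃, mul_pow]
          gcongr
          refine (add_one_pow_le_exp (by positivity) _).trans (Real.exp_le_exp.2 ?_)
          push_cast
          have : (2 * (k : ℝ) + 1) * (2 * k / n) ≤ (3 * k) * (η / 18) := by
            gcongr
            linarith
          nlinarith
        have e₅ : (1 + 3 * (2 * η)) ^ k ≤ Real.exp (6 * η * k) := by
          refine (add_one_pow_le_exp (by positivity) _).trans (le_of_eq ?_)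
          ring_nf
        gcongr
    _ = _ := by
        rw [show 8 * η * k = η * k + (η * k + 6 * η * k) by ring, Real.exp_add, Real.exp_add]
        ring

/-- The trivial bound exceeds the main term by at most `12 ^ k * 3 ^ k = 36 ^ k ≤ exp (4k)`, which
the spare `exp (-bn)` outweighs. -/
lemma exceptional_term_le {η b : ℝ} (hη : 0 < η) (hη1 : η ≤ 1) {n g k : ℕ} (hk : 0 < k)
    (hkn : 36 * (k : ℝ) ≤ η * n) (hkb : 4 * (k : ℝ) ≤ b * n) {E : ℝ} (hE0 : 0 ≤ E)
    (hE6 : E ≤ 6 * k * n)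
    (hbad : 128 * ((n : ℝ) + 1) * Real.exp (-(g ^ 2 / (2 * n))) ≤ η * Real.exp (-(b * n))) :
    128 * n * (n + 1) * Real.exp (-(g ^ 2 / (2 * n))) * ((n + 1) ^ 2 + E) ^ k ≤
      areaMoment k * n ^ (2 * k + 1) * η := by
  have hk1 : (1 : ℝ) ≤ k := by exact_mod_cast hk
  have hn0 : (0 : ℝ) ≤ n := by positivity
  have hηn : η * n ≤ n := by nlinarith
  have hn36 : (36 : ℝ) ≤ n := by linarith
  have hI := areaMoment_pos k
  have e₁ : ((n : ℝ) + 1) ^ 2 + E ≤ 12 * n ^ 2 := by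
    have : 6 * (k : ℝ) * n ≤ 6 * n * n := by
      have : (k : ℝ) ≤ n := by linarith
      nlinarith
    nlinarith
  have e₂ : (12 : ℝ) ^ k ≤ areaMoment k * Real.exp (b * n) := by
    have e₃ : (36 : ℝ) ≤ Real.exp 4 := by
      have := Real.exp_one_gt_d9
      calc (36 : ℝ) ≤ 2.7 ^ 4 := by norm_num
        _ ≤ Real.exp 1 ^ 4 := by gcongr; linarith
        _ = Real.exp 4 := by rw [← Real.exp_nat_mul]; norm_num
    calc (12 : ℝ) ^ k = 12 ^ k * 1 := by ring
      _ ≤ 12 ^ k * (3 ^ k * areaMoment k) := by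
          gcongr
          exact one_le_areaMoment k
      _ = areaMoment k * 36 ^ k := by
          rw [← mul_assoc, ← mul_pow]
          norm_num
          ring
      _ ≤ areaMoment k * Real.exp 4 ^ k := by gcongr
      _ ≤ areaMoment k * Real.exp (b * n) := by
          rw [← Real.exp_nat_mul]
          exact mul_le_mul_of_nonneg_left (Real.exp_le_exp.2 (by linarith)) hI.le
  calc 128 * n * (n + 1) * Real.exp (-(g ^ 2 / (2 * n))) * ((n + 1) ^ 2 + E) ^ k
      = n * (128 * ((n : ℝ) + 1) * Real.exp (-(g ^ 2 / (2 * n)))) * ((n + 1) ^ 2 + E) ^ k := by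
        ring
    _ ≤ n * (η * Real.exp (-(b * n))) * (12 * n ^ 2) ^ k := by gcongr
    _ = 12 ^ k * (n ^ (2 * k + 1) * (η * Real.exp (-(b * n)))) := by
        rw [mul_pow, ← pow_mul]
        ring
    _ ≤ areaMoment k * Real.exp (b * n) * (n ^ (2 * k + 1) * (η * Real.exp (-(b * n)))) := by
        gcongr
    _ = areaMoment k * n ^ (2 * k + 1) * η * (Real.exp (b * n) * Real.exp (-(b * n))) := by
        ring
    _ = _ := by rw [← Real.exp_add, add_neg_cancel, Real.exp_zero, mul_one]

lemma exp_add_le_exp {η : ℝ} (hη : 0 < η) {k : ℝ} (hk1 : 1 ≤ k) :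
    Real.exp (8 * η * k) + η ≤ Real.exp (9 * η * k) := by
  rw [show 9 * η * k = 8 * η * k + η * k by ring, Real.exp_add]
  have e₁ : 1 ≤ Real.exp (8 * η * k) := Real.one_le_exp (by positivity)
  have e₂ := Real.add_one_le_exp (η * k)
  have e₃ : η ≤ η * k := by nlinarith
  nlinarith

lemma card_ASq_upper {η b : ℝ} (hη : 0 < η) (hη1 : η ≤ 1) {n g k : ℕ} (hk : 0 < k)
    (hkn : 36 * (k : ℝ) ≤ η * n) (hkb : 4 * (k : ℝ) ≤ b * n)
    (hg : 1000 * ((g : ℝ) + 1) ≤ η ^ 2 * n)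
    (hbad : 128 * ((n : ℝ) + 1) * Real.exp (-(g ^ 2 / (2 * n))) ≤ η * Real.exp (-(b * n))) :
    32 * (k.factorial : ℝ) * (ASq n k).card ≤
      4 ^ n * (areaMoment k * n ^ (2 * k + 1)) * Real.exp (9 * η * k) := by
  have hk1 : (1 : ℝ) ≤ k := by exact_mod_cast hk
  have hn0 : (0 : ℝ) ≤ n := by positivity
  have hηn : η * n ≤ n := by nlinarith
  have hn36 : (36 : ℝ) ≤ n := by linarith
  have hn : 2 ≤ n := by
    have : (2 : ℝ) ≤ n := by linarith
    exact_mod_cast this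
  have hη2 : η ^ 2 ≤ η := by nlinarith
  have hgn : g + 1 ≤ n := by
    have : ((g : ℝ) + 1) ≤ n := by nlinarith
    exact_mod_cast this
  have hI := areaMoment_pos k
  set E : ℝ := k * (2 * (n + k + 2)) with hE
  have hE0 : 0 ≤ E := by positivity
  have hE6 : E ≤ 6 * k * n := by
    have : 2 * ((n : ℝ) + k + 2) ≤ 6 * n := by linarith
    rw [hE]
    nlinarith
  have h₁ : (k.factorial : ℝ) * (ASq n k).card ≤
      ∑ π ∈ ASq n 0, ((innerCells π).card + E) ^ k := by
    have := Nat.cast_le (α := ℝ).2 (factorial_mul_card_ASq_le n k)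
    push_cast at this
    exact this
  have h₂ := sum_ASq_zero_pow_le hn hgn k hE0
  have hD : 1000 * ((g : ℝ) + 1) * n + E ≤ 2 * η * n ^ 2 := by
    have e₁ : 1000 * ((g : ℝ) + 1) * n ≤ η ^ 2 * n * n := by gcongr
    have e₂ : η ^ 2 * n * n ≤ η * n * n := by gcongr
    have e₃ : 36 * (k : ℝ) * n ≤ η * n * n := by gcongr
    have e₄ : 0 ≤ η * n * n := by positivity
    nlinarith
  have h₃ := sum_weight_mul_area_pow_le hη hη1 hk hkn (by positivity) hD
  simp only [← add_assoc] at h₃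
  have h₄ := exceptional_term_le hη hη1 hk hkn hkb hE0 hE6 hbad
  have h₅ := exp_add_le_exp hη hk1
  calc 32 * (k.factorial : ℝ) * (ASq n k).card
      = 32 * ((k.factorial : ℝ) * (ASq n k).card) := by ring
    _ ≤ 32 * ∑ π ∈ ASq n 0, ((innerCells π).card + E) ^ k := by gcongr
    _ ≤ 4 ^ n * (areaMoment k * n ^ (2 * k + 1) * Real.exp (8 * η * k) +
          areaMoment k * n ^ (2 * k + 1) * η) :=
        h₂.trans (mul_le_mul_of_nonneg_left (add_le_add h₃ h₄) (by positivity))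
    _ = 4 ^ n * (areaMoment k * n ^ (2 * k + 1)) * (Real.exp (8 * η * k) + η) := by ring
    _ ≤ _ := by gcongr

/-- Small areas contribute at most the fraction `(6η)^k` of the main term, while the full sum has at
least `(1-η)^k`; superadditivity of `x ↦ x^k` leaves `(1-7η)^k`. Large area keeps `z` away from the
ends, where codes are injective. -/
lemma le_sum_area_pow_of_large {η : ℝ} (hη : 0 < η) (hη1 : η ≤ 1 / 14) {n k : ℕ} (hk : 0 < k)
    (hkn : 36 * (k : ℝ) ≤ η * n) :
    areaMoment k * n ^ (2 * k + 1) * (1 - 7 * η) ^ k ≤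
      ∑ z ∈ Finset.univ.filter fun z : Fin n => 2 * η * (n : ℝ) ^ 2 ≤ 2 * (z : ℝ) * (n - 1 - z),
        (2 * (z : ℝ) * (n - 1 - z)) ^ k := by
  have hk1 : (1 : ℝ) ≤ k := by exact_mod_cast hk
  have hn0 : (0 : ℝ) ≤ n := by positivity
  have hηn : η * n ≤ n := by nlinarith
  have hn36 : (36 : ℝ) ≤ n := by linarith
  have hI := areaMoment_pos k
  have hkn' : 2 * k < n := by
    have : 2 * (k : ℝ) < n := by linarith
    exact_mod_cast this
  have e₁ := le_sum_range_area_pow hkn'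
  rw [← Fin.sum_univ_eq_sum_range (fun z => (2 * (z : ℝ) * (n - 1 - z)) ^ k),
    ← Finset.sum_filter_add_sum_filter_not Finset.univ
      fun z : Fin n => 2 * η * (n : ℝ) ^ 2 ≤ 2 * (z : ℝ) * (n - 1 - z)] at e₁
  have e₂ : ∑ z ∈ Finset.univ.filter fun z : Fin n => ¬ 2 * η * (n : ℝ) ^ 2 ≤ 2 * (z : ℝ) * (n - 1 - z),
      (2 * (z : ℝ) * (n - 1 - z)) ^ k ≤ n * (2 * η * (n : ℝ) ^ 2) ^ k := by
    refine (Finset.sum_le_card_nsmul _ _ ((2 * η * (n : ℝ) ^ 2) ^ k) fun z hz => ?_).trans ?_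
    · exact pow_le_pow_left₀ (area_nonneg z.isLt) (not_le.1 (Finset.mem_filter.1 hz).2).le k
    · rw [nsmul_eq_mul]
      refine mul_le_mul_of_nonneg_right (Nat.cast_le.2 ?_) (by positivity)
      simpa using Finset.card_le_univ (Finset.univ.filter fun z : Fin n =>
        ¬ 2 * η * (n : ℝ) ^ 2 ≤ 2 * (z : ℝ) * (n - 1 - z))
  have e₃ : n * (2 * η * (n : ℝ) ^ 2) ^ k ≤
      areaMoment k * n ^ (2 * k + 1) * (6 * η) ^ k := by
    calc n * (2 * η * (n : ℝ) ^ 2) ^ k = 1 * (n ^ (2 * k + 1) * (2 * η) ^ k) := by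
          rw [mul_pow, ← pow_mul]
          ring
      _ ≤ 3 ^ k * areaMoment k * (n ^ (2 * k + 1) * (2 * η) ^ k) := by
          gcongr
          exact one_le_areaMoment k
      _ = _ := by
          rw [show 6 * η = 3 * (2 * η) by ring, mul_pow 3]
          ring
  have e₄ : (n : ℝ) ^ (2 * k + 1) * (1 - η) ^ k ≤ (n - 2 * k) ^ (2 * k + 1) := by
    have f₁ : (n : ℝ) * (1 - η / 18) ≤ n - 2 * k := by linarith
    have f₂ : (1 - η) ^ k ≤ (1 - η / 18) ^ (2 * k + 1) := by
      calc (1 - η) ^ k ≤ ((1 - η / 18) ^ 3) ^ k := by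
            refine pow_le_pow_left₀ (by linarith) ?_ k
            nlinarith [sq_nonneg (η / 18)]
        _ = (1 - η / 18) ^ (3 * k) := by rw [pow_mul]
        _ ≤ (1 - η / 18) ^ (2 * k + 1) :=
            pow_le_pow_of_le_one (by linarith) (by linarith) (by omega)
    calc (n : ℝ) ^ (2 * k + 1) * (1 - η) ^ k
        ≤ n ^ (2 * k + 1) * (1 - η / 18) ^ (2 * k + 1) := by gcongr
      _ = (n * (1 - η / 18)) ^ (2 * k + 1) := by rw [mul_pow]
      _ ≤ _ := pow_le_pow_left₀ (mul_nonneg hn0 (by linarith)) f₁ _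
  have e₅ : (1 - 7 * η) ^ k + (6 * η) ^ k ≤ (1 - η) ^ k := by
    have := pow_add_pow_le (show 0 ≤ 1 - 7 * η by linarith) (show 0 ≤ 6 * η by linarith)
      hk.ne'
    rwa [show 1 - 7 * η + 6 * η = 1 - η by ring] at this
  have e₆ := mul_le_mul_of_nonneg_left e₄ hI.le
  have e₇ := mul_le_mul_of_nonneg_left e₅
    (by positivity : 0 ≤ areaMoment k * (n : ℝ) ^ (2 * k + 1))
  rw [mul_add] at e₇
  linarith

/-- Three losses of `(1-7η)^k` occur in the lower bound: unbalanced labels, the area error, and the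
discarded small areas. Each is at least `exp (-14ηk)`, since `(1+14η)(1-7η) ≥ 1` for `η ≤ 1/14`. -/
lemma exp_neg_le_one_sub_pow {η : ℝ} (hη : 0 < η) (hη1 : η ≤ 1 / 14) (k : ℕ) :
    Real.exp (-(42 * η * k)) ≤ (1 - 7 * η) ^ k * ((1 - 7 * η) ^ k * (1 - 7 * η) ^ k) := by
  have e₁ : Real.exp (-(14 * η)) ≤ 1 - 7 * η := by
    rw [Real.exp_neg]
    refine inv_le_of_inv_le₀ (by linarith) (le_trans ?_ (Real.add_one_le_exp _))
    rw [inv_le_iff_one_le_mul₀ (by linarith)]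
    nlinarith
  have e₂ : Real.exp (-(42 * η * k)) = Real.exp (-(14 * η)) ^ (3 * k) := by
    rw [← Real.exp_nat_mul]
    congr 1
    push_cast
    ring
  rw [e₂, show (1 - 7 * η) ^ k * ((1 - 7 * η) ^ k * (1 - 7 * η) ^ k) =
    (1 - 7 * η) ^ (3 * k) by ring]
  exact pow_le_pow_left₀ (Real.exp_pos _).le e₁ _

lemma card_ASq_lower {η b : ℝ} (hη : 0 < η) (hη1 : η ≤ 1 / 14) (hb : 0 < b) {n g k : ℕ}
    (hk : 0 < k) (hkn : 36 * (k : ℝ) ≤ η * n) (hg : 1000 * ((g : ℝ) + 1) ≤ η ^ 2 * n)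
    (hbad : 128 * ((n : ℝ) + 1) * Real.exp (-(g ^ 2 / (2 * n))) ≤ η * Real.exp (-(b * n))) :
    4 ^ n * (areaMoment k * n ^ (2 * k + 1)) * Real.exp (-(42 * η * k)) ≤
      32 * (k.factorial : ℝ) * (ASq n k).card := by
  have hk1 : (1 : ℝ) ≤ k := by exact_mod_cast hk
  have hn0 : (0 : ℝ) ≤ n := by positivity
  have hηn : η * n ≤ n := by nlinarith
  have hn36 : (36 : ℝ) ≤ n := by linarith
  have hn : 2 ≤ n := by
    have : (2 : ℝ) ≤ n := by linarith
    exact_mod_cast this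
  have hη2 : η ^ 2 ≤ η := by nlinarith
  have hI := areaMoment_pos k
  have h₁ : ∑ π ∈ ASq n 0, ((innerCells π).card : ℝ) ^ k ≤
      (k.factorial : ℝ) * (ASq n k).card := by
    exact_mod_cast sum_card_innerCells_pow_le n k
  set S : Finset (Fin n) :=
    Finset.univ.filter fun z => 2 * η * (n : ℝ) ^ 2 ≤ 2 * (z : ℝ) * (n - 1 - z) with hS
  have hD : 1000 * ((g : ℝ) + 1) * n ≤ η * (η * n ^ 2) := by
    have e₁ : 1000 * ((g : ℝ) + 1) * n ≤ η ^ 2 * n * n := by gcongr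
    linarith
  have hSz : ∀ z ∈ S, 8 * (g + 1) < (z : ℕ) ∧ z + 8 * (g + 1) < n ∧
      0 ≤ 2 * (z : ℝ) * (n - 1 - z) - 1000 * (g + 1) * n := by
    intro z hz
    have hz' := (Finset.mem_filter.1 hz).2
    have hzn : ((z : ℕ) : ℝ) + 1 ≤ n := by exact_mod_cast z.isLt
    have hz0 : (0 : ℝ) ≤ ((z : ℕ) : ℝ) := by positivity
    have hnpos : (0 : ℝ) < n := by linarith
    have hg8 : 8 * ((g : ℝ) + 1) < η * n := by
      have : η ^ 2 * n ≤ η * n := by gcongr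
      have : 0 < η * n := by positivity
      linarith
    refine ⟨?_, ?_, ?_⟩
    · have : η * n ≤ z := by
        by_contra! h
        nlinarith
      have : ((8 * (g + 1) : ℕ) : ℝ) < (z : ℕ) := by
        push_cast
        linarith
      exact_mod_cast this
    · have : η * n ≤ n - 1 - z := by
        by_contra! h
        nlinarith
      have : ((z + 8 * (g + 1) : ℕ) : ℝ) < n := by
        push_cast
        linarith
      exact_mod_cast this
    · nlinarith
  have h₂ := le_sum_ASq_zero_pow (g := g) hn k S hSz
  have h₃ : (1 - η) ^ k * ∑ z ∈ S, (2 * (z : ℝ) * (n - 1 - z)) ^ k ≤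
      ∑ z ∈ S, (2 * (z : ℝ) * (n - 1 - z) - 1000 * (g + 1) * n) ^ k := by
    rw [Finset.mul_sum]
    refine Finset.sum_le_sum fun z hz => ?_
    have hz' := (Finset.mem_filter.1 hz).2
    have := area_nonneg z.isLt
    rw [← mul_pow]
    refine pow_le_pow_left₀ (mul_nonneg (by linarith) this) ?_ k
    nlinarith
  have h₄ := le_sum_area_pow_of_large hη hη1 hk hkn
  rw [← hS] at h₄
  have h₅ : 1 - 7 * η ≤ 1 - 128 * ((n : ℝ) + 1) * Real.exp (-(g ^ 2 / (2 * n))) := by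
    have : Real.exp (-(b * n)) ≤ 1 := Real.exp_le_one_iff.2 (by
      have : 0 ≤ b * n := by positivity
      linarith)
    nlinarith
  have hη7 : 0 ≤ 1 - 7 * η := by linarith
  have h₆ := exp_neg_le_one_sub_pow hη hη1 k
  -- The constant loss `1 - 7η` is written as a `k`-th power; this needs `k ≥ 1`.
  have h₇ : (1 - 7 * η) ^ k ≤ 1 - 128 * ((n : ℝ) + 1) * Real.exp (-(g ^ 2 / (2 * n))) :=
    (pow_le_of_le_one hη7 (by linarith) hk.ne').trans h₅
  have hT : 0 ≤ ∑ z ∈ S, (2 * (z : ℝ) * (n - 1 - z)) ^ k :=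
    Finset.sum_nonneg fun z _ => pow_nonneg (area_nonneg z.isLt) k
  have hη1k : 0 ≤ (1 - η) ^ k := pow_nonneg (by linarith) k
  have hη7k : 0 ≤ (1 - 7 * η) ^ k := pow_nonneg hη7 k
  have h₈ : (1 - 7 * η) ^ k ≤ (1 - η) ^ k := pow_le_pow_left₀ hη7 (by linarith) k
  calc 4 ^ n * (areaMoment k * n ^ (2 * k + 1)) * Real.exp (-(42 * η * k))
      ≤ 4 ^ n * (areaMoment k * n ^ (2 * k + 1)) *
          ((1 - 7 * η) ^ k * ((1 - 7 * η) ^ k * (1 - 7 * η) ^ k)) := by gcongr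
    _ = 4 ^ n * ((1 - 7 * η) ^ k * ((1 - 7 * η) ^ k *
          (areaMoment k * n ^ (2 * k + 1) * (1 - 7 * η) ^ k))) := by ring
    _ ≤ 4 ^ n * ((1 - 7 * η) ^ k * ((1 - η) ^ k *
          ∑ z ∈ S, (2 * (z : ℝ) * (n - 1 - z)) ^ k)) := by gcongr
    _ ≤ 4 ^ n * ((1 - 128 * ((n : ℝ) + 1) * Real.exp (-(g ^ 2 / (2 * n)))) *
          ∑ z ∈ S, (2 * (z : ℝ) * (n - 1 - z) - 1000 * (g + 1) * n) ^ k) := by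
        exact mul_le_mul_of_nonneg_left
          (mul_le_mul h₇ h₃ (mul_nonneg hη1k hT) (hη7k.trans h₇)) (by positivity)
    _ ≤ 32 * ∑ π ∈ ASq n 0, ((innerCells π).card : ℝ) ^ k := h₂
    _ ≤ 32 * ((k.factorial : ℝ) * (ASq n k).card) := by gcongr
    _ = _ := by ring

/-- The constants agree because `2^(k+1) * 4^(n-3) = 2^k * 4^n / 32`. The exponent `n - 3` is an
integer, possibly negative. -/
lemma factorial_mul_mainTerm (n k : ℕ) :
    32 * (k.factorial : ℝ) * ((k.factorial : ℝ) / ((2 * k + 1).factorial : ℝ) *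
      (2 : ℝ) ^ (k + 1) * (n : ℝ) ^ (2 * k + 1) * (4 : ℝ) ^ ((n : ℤ) - 3)) =
      4 ^ n * (areaMoment k * n ^ (2 * k + 1)) := by
  rw [zpow_sub₀ (by norm_num), zpow_natCast, areaMoment]
  norm_num
  field_simp
  ring

theorem theorem1p2 (k : ℕ → ℕ) (hk_pos : ∀ᶠ n in atTop, 0 < k n)
    (hk : (fun n : ℕ => (k n : ℝ)) =o[atTop] (fun n : ℕ => (n : ℝ))) :
    (fun n : ℕ =>
        Real.log ((ASq n (k n)).card : ℝ) -
          Real.log (((k n).factorial : ℝ) / ((2 * k n + 1).factorial : ℝ) *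
            (2 : ℝ) ^ (k n + 1) * (n : ℝ) ^ (2 * k n + 1) * (4 : ℝ) ^ ((n : ℤ) - 3)))
      =o[atTop] (fun n : ℕ => (k n : ℝ)) := by
  rw [isLittleO_iff]
  intro ε hε
  -- The lower bound loses `exp (-42ηk)` and the upper one only `exp (9ηk)`, so `42η ≤ ε` suffices
  -- for both.
  set η : ℝ := min (ε / 42) (1 / 14)
  have hη : 0 < η := by positivity
  have hηε : 42 * η ≤ ε := by
    have := min_le_left (ε / 42) (1 / 14)
    linarith
  have hη1 : η ≤ 1 / 14 := min_le_right _ _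
  obtain ⟨b, hb, hscale⟩ := exists_fluctuation_scale hη
  filter_upwards [hk_pos, hscale, eventually_gt_atTop 0,
    hk.bound (show 0 < η / 36 by positivity), hk.bound (show 0 < b / 4 by positivity)]
    with n hkn hscale hn h₁ h₂
  obtain ⟨g, hg, hbad⟩ := hscale
  simp only [Real.norm_natCast] at h₁ h₂
  have hn' : (0 : ℝ) < n := by exact_mod_cast hn
  have hup := card_ASq_upper hη (by linarith) hkn (by linarith) (by linarith) hg hbad
  have hlo := card_ASq_lower hη hη1 hb hkn (by linarith) hg hbad
  rw [← factorial_mul_mainTerm] at hup hlo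
  set F : ℝ := ((k n).factorial : ℝ) / ((2 * k n + 1).factorial : ℝ) *
    (2 : ℝ) ^ (k n + 1) * (n : ℝ) ^ (2 * k n + 1) * (4 : ℝ) ^ ((n : ℤ) - 3)
  have hF : 0 < F := by positivity
  have hfac : 0 < 32 * ((k n).factorial : ℝ) := by positivity
  rw [mul_assoc _ F] at hup hlo
  have hup' := le_of_mul_le_mul_left hup hfac
  have hlo' := le_of_mul_le_mul_left hlo hfac
  have hpos : 0 < F * Real.exp (-(42 * η * k n)) := by positivity
  have hlog₁ := Real.log_le_log (hpos.trans_le hlo') hup'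
  have hlog₂ := Real.log_le_log hpos hlo'
  rw [Real.log_mul hF.ne' (Real.exp_pos _).ne', Real.log_exp] at hlog₁ hlog₂
  have hk0 : (0 : ℝ) ≤ k n := by positivity
  rw [Real.norm_natCast, Real.norm_eq_abs, abs_le]
  constructor <;> nlinarith
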